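/- Let $\Lambda$ be an arbitrary ring (associative, with $1$), let $\mathbf C=(\cdots\to C_{n+1}\to C_n\to C_{n-1}\to\cdots)$, indexed by $\mathbb Z$, be a complex of flat right $\Lambda$-modules with boundaries $B_n=\operatorname{im}(C_{n+1}\to C_n)$, let $n\in\mathbb Z$, and let $F:=H_n(\mathbf C\otimes_\Lambda -)$, an additive functor from left $\Lambda$-modules to abelian groups. For an additive functor $F$, let $L_iF$ be its left derived functors, let $\underline F:=\operatorname{coker}(\lambda_F:L_0F\to F)$ be its quot-stabilization, and, for a projective resolution $\cdots\to P_1\to P_0\to B\to 0$ with syzygies $\Omega^0B=B$ and $\Omega^{i+1}B=\ker(P_i\to\Omega^iB)$, let $(\underline F\circ\Omega^i)(B)=\underline F(\Omega^iB)$ and let the left satellites be $S_iF(B)=\ker\big(F(\Omega^iB)\to F(P_{i-1})\big)$, $i\ge 1$. The left fundamental sequence of $F$ is the sequence of functors $$\cdots\to L_2F\to S_2F\to\underline F\circ\Omega^2\to L_1F\to S_1F\to\underline F\circ\Omega\to L_0F\xrightarrow{\lambda_F}F\to\underline F\to 0,$$ in which $L_iF(B)=H_i(F(P_\bullet))\to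 S_iF(B)$ is induced by $F(P_i)\to F(\Omega^iB)$, the map $S_iF(B)\to\underline F(\Omega^iB)$ is the inclusion into $F(\Omega^iB)$ followed by the projection, and $\underline F(\Omega^{i+1}B)\to L_iF(B)$ is induced by $F(\Omega^{i+1}B)\to F(P_i)$. Then the left fundamental sequence of $F=H_n(\mathbf C\otimes_\Lambda-)$ is exact and, for any choice of projective resolutions, isomorphic, as a sequence of functors, to an exact sequence $$\begin{aligned}\cdots&\to\operatorname{Tor}_{i}(H_n(\mathbf C),-)\to\operatorname{Tor}_{i}(C_n/B_n,-)\to\operatorname{Tor}_{i+1}(C_{n-1}/B_{n-1},-)\to\operatorname{Tor}_{i-1}(H_n(\mathbf C),-)\to\cdots\\&\to\operatorname{Tor}_1(H_n(\mathbf C),-)\to\operatorname{Tor}_1(C_n/B_n,-)\to\operatorname{Tor}_2(C_{n-1}/B_{n-1},-)\\&\to H_n(\mathbf C)\otimes-\xrightarrow{\ \kappa\ }H_n(\mathbf C\otimes-)\to\operatorname{Tor}_1(C_{n-1}/B_{n-1},-)\to 0,\end{aligned}$$ where $\kappa([z]\otimes b)=[z\otimes b]$ is the canonical map. In particular there are natural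 isomorphisms $L_0F\cong H_n(\mathbf C)\otimes-$, carrying $\lambda_F$ to $\kappa$, $L_iF\cong\operatorname{Tor}_i(H_n(\mathbf C),-)$ for $i\ge1$, induced by $\kappa$ on left derived functors, $S_iF\cong\operatorname{Tor}_i(C_n/B_n,-)$ for $i\ge 1$, and $\underline F\circ\Omega^i\cong\operatorname{Tor}_{i+1}(C_{n-1}/B_{n-1},-)$ for $i\ge 0$; the isomorphism of sequences is the identity on $F$. -/

import Mathlib

open CategoryTheory CategoryTheory.Limits
open scoped TensorProduct

universe v u v' u'

/-! ### Syzygies attached to a projective resolution -/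

namespace CategoryTheory.ProjectiveResolution

variable {𝒜 : Type u} [Category.{v} 𝒜] [Abelian 𝒜]

/-- The `i`-th syzygy object `Ωⁱ B` of `B` computed by the projective resolution
`⋯ ⟶ P₁ ⟶ P₀ ⟶ B`, realized as the cokernel of `P_{i+1} ⟶ P_i`. By `syzygy_shortExact` and
`syzygyZeroIso` below, `Ω⁰ B ≅ B` and `Ω^{i+1} B` is the kernel of an epimorphism from the
projective object `P_i` onto `Ωⁱ B`. -/
noncomputable abbrev syzygy {B : 𝒜} (P : ProjectiveResolution B) (i : ℕ) : 𝒜 :=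
  P.complex.opcycles i

/-- The projective cover map `P_i ⟶ Ωⁱ B`. -/
noncomputable abbrev toSyzygy {B : 𝒜} (P : ProjectiveResolution B) (i : ℕ) :
    P.complex.X i ⟶ P.syzygy i :=
  P.complex.pOpcycles i

/-- The inclusion `Ω^{i+1} B ⟶ P_i`. -/
noncomputable abbrev syzygyι {B : 𝒜} (P : ProjectiveResolution B) (i : ℕ) :
    P.syzygy (i + 1) ⟶ P.complex.X i :=
  P.complex.fromOpcycles (i + 1) i

theorem syzygyι_toSyzygy {B : 𝒜} (P : ProjectiveResolution B) (i : ℕ) :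
    P.syzygyι i ≫ P.toSyzygy i = 0 := by
  rw [← cancel_epi (P.complex.pOpcycles (i + 1))]
  simp

theorem syzygy_shortExact {B : 𝒜} (P : ProjectiveResolution B) (i : ℕ) :
    (ShortComplex.mk (P.syzygyι i) (P.toSyzygy i) (P.syzygyι_toSyzygy i)).ShortExact := by
  have hm : Mono (P.syzygyι i) := by
    refine Preadditive.mono_of_isZero_kernel'
      _ (P.complex.homologyIsKernel (i + 1) i (by simp)) ?_
    exact (P.complex.exactAt_iff_isZero_homology (i + 1)).1 (P.complex_exactAt_succ i)
  have hd : (ShortComplex.mk (P.complex.d (i + 1) i) (P.toSyzygy i) (by simp)).Exact :=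
    ShortComplex.exact_of_g_is_cokernel _ (P.complex.opcyclesIsCokernel (i + 1) i (by simp))
  refine ⟨?_⟩
  exact (ShortComplex.exact_iff_of_epi_of_isIso_of_mono
    (S₁ := ShortComplex.mk (P.complex.d (i + 1) i) (P.toSyzygy i) (by simp))
    (S₂ := ShortComplex.mk (P.syzygyι i) (P.toSyzygy i) (P.syzygyι_toSyzygy i))
    { τ₁ := P.complex.pOpcycles (i + 1), τ₂ := 𝟙 _, τ₃ := 𝟙 _ }).1 hd

/-- `Ω⁰ B ≅ B`. -/
noncomputable def syzygyZeroIso {B : 𝒜} (P : ProjectiveResolution B) : P.syzygy 0 ≅ B :=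
  (P.complex.opcyclesIsCokernel 1 0 (by simp)).coconePointUniqueUpToIso P.isColimitCokernelCofork

/-- The map induced on `i`-th syzygies by a map of resolutions. -/
noncomputable def syzygyMap {B B' : 𝒜} {P : ProjectiveResolution B}
    {P' : ProjectiveResolution B'} (φ : P.complex ⟶ P'.complex) (i : ℕ) :
    P.syzygy i ⟶ P'.syzygy i :=
  HomologicalComplex.opcyclesMap φ i

theorem syzygyMap_id {B : 𝒜} (P : ProjectiveResolution B) (i : ℕ) :
    syzygyMap (P := P) (P' := P) (𝟙 P.complex) i = 𝟙 (P.syzygy i) :=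
  HomologicalComplex.opcyclesMap_id _ _

theorem syzygyMap_comp {B B' B'' : 𝒜} {P : ProjectiveResolution B}
    {P' : ProjectiveResolution B'} {P'' : ProjectiveResolution B''}
    (φ : P.complex ⟶ P'.complex) (ψ : P'.complex ⟶ P''.complex) (i : ℕ) :
    syzygyMap (P := P) (P' := P'') (φ ≫ ψ) i =
      syzygyMap (P := P) (P' := P') φ i ≫ syzygyMap (P := P') (P' := P'') ψ i :=
  HomologicalComplex.opcyclesMap_comp _ _ _

theorem toSyzygy_syzygyMap {B B' : 𝒜} {P : ProjectiveResolution B}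
    {P' : ProjectiveResolution B'} (φ : P.complex ⟶ P'.complex) (i : ℕ) :
    P.toSyzygy i ≫ syzygyMap (P := P) (P' := P') φ i = φ.f i ≫ P'.toSyzygy i :=
  HomologicalComplex.p_opcyclesMap _ _

theorem syzygyι_naturality {B B' : 𝒜} {P : ProjectiveResolution B}
    {P' : ProjectiveResolution B'} (φ : P.complex ⟶ P'.complex) (i : ℕ) :
    P.syzygyι i ≫ φ.f i = syzygyMap (P := P) (P' := P') φ (i + 1) ≫ P'.syzygyι i := by
  rw [← cancel_epi (P.complex.pOpcycles (i + 1))]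
  simp [syzygyMap]

/-- Two homotopic maps of resolutions induce maps `Ω^{i+1} B ⟶ Ω^{i+1} B'` whose difference
factors through `Ω^{i+1} B ⟶ P_i`. -/
theorem syzygyMap_succ_eq {B B' : 𝒜} {P : ProjectiveResolution B}
    {P' : ProjectiveResolution B'} {φ ψ : P.complex ⟶ P'.complex} (h : Homotopy φ ψ) (i : ℕ) :
    syzygyMap (P := P) (P' := P') φ (i + 1) =
      P.syzygyι i ≫ h.hom i (i + 1) ≫ P'.toSyzygy (i + 1) + syzygyMap ψ (i + 1) := by
  rw [← cancel_epi (P.complex.pOpcycles (i + 1))]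
  have := h.comm (i + 1)
  rw [dNext_eq h.hom (i := i + 1) (i' := i) (by simp),
    prevD_eq h.hom (j := i + 1) (j' := i + 2) (by simp)] at this
  simp [this, syzygyMap]

theorem syzygyMap_zero_eq {B B' : 𝒜} {P : ProjectiveResolution B}
    {P' : ProjectiveResolution B'} {φ ψ : P.complex ⟶ P'.complex} (h : Homotopy φ ψ) :
    syzygyMap (P := P) (P' := P') φ 0 = syzygyMap ψ 0 := by
  rw [← cancel_epi (P.complex.pOpcycles 0)]
  have := h.comm 0
  rw [dNext_eq_zero _ _ (by simp), prevD_eq h.hom (j := 0) (j' := 1) (by simp)] at this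
  simp [this, syzygyMap]

end CategoryTheory.ProjectiveResolution

/-! ### The left fundamental sequence of an additive functor -/

section LeftFundamentalSequence

theorem CategoryTheory.comp_eq_of_squares {𝒟 : Type u} [Category.{v} 𝒟] {X X' Y Y' Z Z' : 𝒟} {a : X ⟶ X'} {h : X ⟶ Y} {h' : X' ⟶ Y'}
    {m : Y ⟶ Y'} {k : Y ⟶ Z} {k' : Y' ⟶ Z'} {s : Z ⟶ Z'} (e : a ≫ h' = h ≫ m)
    (e' : m ≫ k' = k ≫ s) : a ≫ h' ≫ k' = (h ≫ k) ≫ s := by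
  rw [← Category.assoc, e, Category.assoc, e', Category.assoc]

variable {𝒜 : Type u} [Category.{v} 𝒜] [Abelian 𝒜] {ℬ : Type u'} [Category.{v'} ℬ] [Abelian ℬ]

namespace CategoryTheory.Functor

section Objectwise

variable (F : 𝒜 ⥤ ℬ) [F.Additive] {B B' : 𝒜} (P : ProjectiveResolution B)
  (P' : ProjectiveResolution B')

theorem kernel_comp_map_syzygyMap_eq {P : ProjectiveResolution B} {P' : ProjectiveResolution B'}
    {φ ψ : P.complex ⟶ P'.complex} (h : Homotopy φ ψ) (i : ℕ) :
    Limits.kernel.ι (F.map (P.syzygyι i)) ≫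
        F.map (ProjectiveResolution.syzygyMap (P := P) (P' := P') φ (i + 1)) =
      Limits.kernel.ι (F.map (P.syzygyι i)) ≫
        F.map (ProjectiveResolution.syzygyMap (P := P) (P' := P') ψ (i + 1)) := by
  rw [ProjectiveResolution.syzygyMap_succ_eq h, F.map_add, F.map_comp, Preadditive.comp_add,
    Limits.kernel.condition_assoc, zero_comp, zero_add]

/-- `F` applied to the complex of the resolution. -/
noncomputable abbrev mapResolution : ChainComplex ℬ ℕ :=
  (F.mapHomologicalComplex (ComplexShape.down ℕ)).obj P.complex

/-- `F (P_i) ⟶ F (Ωⁱ B)`. -/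
noncomputable def mapToSyzygy (i : ℕ) : (F.mapResolution P).X i ⟶ F.obj (P.syzygy i) :=
  F.map (P.toSyzygy i)

/-- `F (Ω^{i+1} B) ⟶ F (P_i)`. -/
noncomputable def mapSyzygyι (i : ℕ) : F.obj (P.syzygy (i + 1)) ⟶ (F.mapResolution P).X i :=
  F.map (P.syzygyι i)

theorem d_mapToSyzygy (i : ℕ) : (F.mapResolution P).d (i + 1) i ≫ F.mapToSyzygy P i = 0 := by
  have : F.map (P.complex.d (i + 1) i) ≫ F.map (P.toSyzygy i) = 0 := by
    rw [← F.map_comp, HomologicalComplex.d_pOpcycles, F.map_zero]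
  exact this

theorem mapSyzygyι_d (i j : ℕ) : F.mapSyzygyι P i ≫ (F.mapResolution P).d i j = 0 := by
  have : F.map (P.syzygyι i) ≫ F.map (P.complex.d i j) = 0 := by
    rw [← F.map_comp, HomologicalComplex.fromOpcycles_d, F.map_zero]
  exact this

theorem mapToSyzygy_mapSyzygyι (i : ℕ) :
    F.mapToSyzygy P (i + 1) ≫ F.mapSyzygyι P i = (F.mapResolution P).d (i + 1) i := by
  have : F.map (P.toSyzygy (i + 1)) ≫ F.map (P.syzygyι i) = F.map (P.complex.d (i + 1) i) := by
    rw [← F.map_comp, HomologicalComplex.p_fromOpcycles]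
  exact this

/-- The map `F (P_i) / F (P_{i+1}) ⟶ F (Ωⁱ B)` induced by `F (P_i) ⟶ F (Ωⁱ B)`. -/
noncomputable def opcyclesToMapSyzygy (i : ℕ) :
    (F.mapResolution P).opcycles i ⟶ F.obj (P.syzygy i) :=
  (F.mapResolution P).descOpcycles (F.mapToSyzygy P i) (i + 1) (by simp) (F.d_mapToSyzygy P i)

theorem pOpcycles_opcyclesToMapSyzygy (i : ℕ) :
    (F.mapResolution P).pOpcycles i ≫ F.opcyclesToMapSyzygy P i = F.mapToSyzygy P i :=
  HomologicalComplex.p_descOpcycles _ _ _ _ _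

theorem opcyclesToMapSyzygy_comp (i : ℕ) :
    F.opcyclesToMapSyzygy P (i + 1) ≫ F.mapSyzygyι P i =
      (F.mapResolution P).fromOpcycles (i + 1) i := by
  rw [← cancel_epi ((F.mapResolution P).pOpcycles (i + 1)), HomologicalComplex.p_fromOpcycles,
    ← Category.assoc, pOpcycles_opcyclesToMapSyzygy, mapToSyzygy_mapSyzygyι]

/-- The map `F (Ω^{i+1} B) ⟶ Z_i (F P)` induced by `F (Ω^{i+1} B) ⟶ F (P_i)`. -/
noncomputable def mapSyzygyToCycles (i : ℕ) :
    F.obj (P.syzygy (i + 1)) ⟶ (F.mapResolution P).cycles i :=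
  (F.mapResolution P).liftCycles (F.mapSyzygyι P i) _ rfl (F.mapSyzygyι_d P i _)

theorem mapSyzygyToCycles_iCycles (i : ℕ) :
    F.mapSyzygyToCycles P i ≫ (F.mapResolution P).iCycles i = F.mapSyzygyι P i :=
  HomologicalComplex.liftCycles_i _ _ _ _ _

theorem mapToSyzygy_mapSyzygyToCycles (i : ℕ) :
    F.mapToSyzygy P (i + 1) ≫ F.mapSyzygyToCycles P i =
      (F.mapResolution P).toCycles (i + 1) i := by
  rw [← cancel_mono ((F.mapResolution P).iCycles i), Category.assoc, mapSyzygyToCycles_iCycles,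
    HomologicalComplex.toCycles_i, mapToSyzygy_mapSyzygyι]

theorem mapToSyzygy_mapSyzygyToCycles_homologyπ (i : ℕ) :
    F.mapToSyzygy P (i + 1) ≫ F.mapSyzygyToCycles P i ≫ (F.mapResolution P).homologyπ i = 0 := by
  rw [← Category.assoc, mapToSyzygy_mapSyzygyToCycles,
    HomologicalComplex.toCycles_comp_homologyπ]

theorem homologyι_opcyclesToMapSyzygy_comp (i : ℕ) :
    ((F.mapResolution P).homologyι (i + 1) ≫ F.opcyclesToMapSyzygy P (i + 1)) ≫
      F.mapSyzygyι P i = 0 := by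
  rw [Category.assoc, opcyclesToMapSyzygy_comp, HomologicalComplex.homologyι_comp_fromOpcycles]

/-- The map `H_{i+1}(F P) ⟶ ker (F (Ω^{i+1} B) ⟶ F (P_i))` induced by
`F (P_{i+1}) ⟶ F (Ω^{i+1} B)`. -/
noncomputable def homologyToSatellite (i : ℕ) :
    (F.mapResolution P).homology (i + 1) ⟶ Limits.kernel (F.map (P.syzygyι i)) :=
  Limits.kernel.lift _ ((F.mapResolution P).homologyι (i + 1) ≫ F.opcyclesToMapSyzygy P (i + 1))
    (F.homologyι_opcyclesToMapSyzygy_comp P i)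

theorem homologyToSatellite_ι (i : ℕ) :
    F.homologyToSatellite P i ≫ Limits.kernel.ι (F.map (P.syzygyι i)) =
      (F.mapResolution P).homologyι (i + 1) ≫ F.opcyclesToMapSyzygy P (i + 1) :=
  Limits.kernel.lift_ι _ _ _

/-- `F` applied to a map of resolutions. -/
noncomputable abbrev mapResolutionMap {P : ProjectiveResolution B} {P' : ProjectiveResolution B'}
    (φ : P.complex ⟶ P'.complex) : F.mapResolution P ⟶ F.mapResolution P' :=
  (F.mapHomologicalComplex (ComplexShape.down ℕ)).map φ

theorem mapToSyzygy_naturality {P : ProjectiveResolution B} {P' : ProjectiveResolution B'}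
    (φ : P.complex ⟶ P'.complex) (i : ℕ) :
    (F.mapResolutionMap φ).f i ≫ F.mapToSyzygy P' i =
      F.mapToSyzygy P i ≫ F.map (ProjectiveResolution.syzygyMap (P := P) (P' := P') φ i) := by
  have : F.map (φ.f i) ≫ F.map (P'.toSyzygy i) =
      F.map (P.toSyzygy i) ≫ F.map (ProjectiveResolution.syzygyMap (P := P) (P' := P') φ i) := by
    rw [← F.map_comp, ← F.map_comp, ProjectiveResolution.toSyzygy_syzygyMap]
  exact this

theorem mapSyzygyι_naturality {P : ProjectiveResolution B} {P' : ProjectiveResolution B'}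
    (φ : P.complex ⟶ P'.complex) (i : ℕ) :
    F.mapSyzygyι P i ≫ (F.mapResolutionMap φ).f i =
      F.map (ProjectiveResolution.syzygyMap (P := P) (P' := P') φ (i + 1)) ≫
        F.mapSyzygyι P' i := by
  have : F.map (P.syzygyι i) ≫ F.map (φ.f i) =
      F.map (ProjectiveResolution.syzygyMap (P := P) (P' := P') φ (i + 1)) ≫
        F.map (P'.syzygyι i) := by
    rw [← F.map_comp, ← F.map_comp, ProjectiveResolution.syzygyι_naturality]
  exact this

theorem opcyclesToMapSyzygy_naturality {P : ProjectiveResolution B} {P' : ProjectiveResolution B'}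
    (φ : P.complex ⟶ P'.complex) (i : ℕ) :
    HomologicalComplex.opcyclesMap (F.mapResolutionMap φ) i ≫ F.opcyclesToMapSyzygy P' i =
      F.opcyclesToMapSyzygy P i ≫
        F.map (ProjectiveResolution.syzygyMap (P := P) (P' := P') φ i) := by
  rw [← cancel_epi ((F.mapResolution P).pOpcycles i), HomologicalComplex.p_opcyclesMap_assoc,
    pOpcycles_opcyclesToMapSyzygy, ← Category.assoc, pOpcycles_opcyclesToMapSyzygy,
    mapToSyzygy_naturality]

theorem mapSyzygyToCycles_naturality {P : ProjectiveResolution B} {P' : ProjectiveResolution B'}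
    (φ : P.complex ⟶ P'.complex) (i : ℕ) :
    F.mapSyzygyToCycles P i ≫ HomologicalComplex.cyclesMap (F.mapResolutionMap φ) i =
      F.map (ProjectiveResolution.syzygyMap (P := P) (P' := P') φ (i + 1)) ≫
        F.mapSyzygyToCycles P' i := by
  rw [← cancel_mono ((F.mapResolution P').iCycles i), Category.assoc, Category.assoc,
    HomologicalComplex.cyclesMap_i, mapSyzygyToCycles_iCycles, ← Category.assoc,
    mapSyzygyToCycles_iCycles, mapSyzygyι_naturality]

end Objectwise

variable [HasProjectiveResolutions 𝒜] (F : 𝒜 ⥤ ℬ) [F.Additive]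

/-- The quot-stabilization of `F`: the cokernel of `L₀F ⟶ F`. -/
noncomputable def quotStab : 𝒜 ⥤ ℬ where
  obj B := cokernel (F.fromLeftDerivedZero.app B)
  map f := cokernel.map _ _ ((F.leftDerived 0).map f) (F.map f)
    (F.fromLeftDerivedZero.naturality f).symm

/-- The projection of `F` onto its quot-stabilization. -/
noncomputable def toQuotStab : F ⟶ F.quotStab where
  app B := cokernel.π (F.fromLeftDerivedZero.app B)
  naturality _ _ _ := by simp [quotStab]

instance epi_toQuotStab_app (B : 𝒜) : Epi (F.toQuotStab.app B) :=
  inferInstanceAs (Epi (cokernel.π (F.fromLeftDerivedZero.app B)))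

theorem isZero_quotStab_obj (P : 𝒜) [Projective P] : IsZero (F.quotStab.obj P) :=
  isZero_cokernel_of_epi (F.fromLeftDerivedZero.app P)

instance additive_quotStab : F.quotStab.Additive where
  map_add {X Y f g} := by
    rw [← cancel_epi (F.toQuotStab.app X)]
    simp [← NatTrans.naturality]

/-- If `p : Q ⟶ B` is an epimorphism, then a map out of `F B` that vanishes on `F Q` vanishes
on the image of `L₀F B`. -/
theorem fromLeftDerivedZero_comp_eq_zero {Q B : 𝒜} (p : Q ⟶ B) (hp : Epi p) {Z : ℬ}
    (g : F.obj B ⟶ Z) (w : F.map p ≫ g = 0) : F.fromLeftDerivedZero.app B ≫ g = 0 := by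
  have h : (projectiveResolution B).fromLeftDerivedZero' F ≫ g = 0 := by
    rw [← cancel_epi (HomologicalComplex.pOpcycles _ _),
      (projectiveResolution B).pOpcycles_comp_fromLeftDerivedZero'_assoc F, comp_zero]
    have key : ∀ (a : (projectiveResolution B).complex.X 0 ⟶ B), F.map a ≫ g = 0 := fun a => by
      rw [← Projective.factorThru_comp a p, F.map_comp, Category.assoc, w, comp_zero]
    exact key _
  rw [(projectiveResolution B).fromLeftDerivedZero_eq F]
  have h' : (ChainComplex.isoHomologyι₀ (F.mapResolution (projectiveResolution B))).hom ≫
      (projectiveResolution B).fromLeftDerivedZero' F ≫ g = 0 := by rw [h, comp_zero]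
  rw [← Category.assoc] at h'
  rw [Category.assoc]
  refine (congrArg (((projectiveResolution B).isoLeftDerivedObj F 0).hom ≫ ·) h').trans ?_
  exact comp_zero

variable (R : ∀ B : 𝒜, ProjectiveResolution B)

/-- Homotopic maps of resolutions act in the same way on `F̲ (Ωⁱ B)`. -/
theorem quotStab_map_syzygyMap_eq {B B' : 𝒜} {P : ProjectiveResolution B}
    {P' : ProjectiveResolution B'} {φ ψ : P.complex ⟶ P'.complex} (h : Homotopy φ ψ) (i : ℕ) :
    F.quotStab.map (ProjectiveResolution.syzygyMap (P := P) (P' := P') φ i) =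
      F.quotStab.map (ProjectiveResolution.syzygyMap (P := P) (P' := P') ψ i) := by
  cases i with
  | zero => rw [ProjectiveResolution.syzygyMap_zero_eq h]
  | succ i =>
    rw [ProjectiveResolution.syzygyMap_succ_eq h, Functor.map_add, Functor.map_comp,
      (F.isZero_quotStab_obj (P.complex.X i)).eq_zero_of_tgt (F.quotStab.map (P.syzygyι i)),
      zero_comp, zero_add]

/-- The functor `F̲ ∘ Ωⁱ`, where `F̲` is the quot-stabilization of `F`; a map `B ⟶ B'` acts through
any lift to the chosen projective resolutions. -/
noncomputable def quotStabSyzygy (i : ℕ) : 𝒜 ⥤ ℬ where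
  obj B := F.quotStab.obj ((R B).syzygy i)
  map {B B'} f := F.quotStab.map
    (ProjectiveResolution.syzygyMap (ProjectiveResolution.lift f (R B) (R B')) i)
  map_id B := by
    rw [F.quotStab_map_syzygyMap_eq (ProjectiveResolution.liftIdHomotopy B (R B)) i,
      ProjectiveResolution.syzygyMap_id, Functor.map_id]
  map_comp {X Y Z} f g := by
    rw [F.quotStab_map_syzygyMap_eq
      (ProjectiveResolution.liftCompHomotopy f g (R X) (R Y) (R Z)) i,
      ProjectiveResolution.syzygyMap_comp, Functor.map_comp]

/-- The left satellite `S_{i+1} F`, whose value at `B` is the kernel of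
`F (Ω^{i+1} B) ⟶ F (P_i)`; a map `B ⟶ B'` acts through any lift to the chosen projective
resolutions. -/
noncomputable def leftSatelliteSucc (i : ℕ) : 𝒜 ⥤ ℬ where
  obj B := Limits.kernel (F.map ((R B).syzygyι i))
  map {B B'} f := Limits.kernel.map _ _
    (F.map (ProjectiveResolution.syzygyMap (ProjectiveResolution.lift f (R B) (R B')) (i + 1)))
    (F.map ((ProjectiveResolution.lift f (R B) (R B')).f i))
    (by rw [← F.map_comp, ← F.map_comp, ProjectiveResolution.syzygyι_naturality])
  map_id B := by
    rw [← cancel_mono (Limits.kernel.ι _), Limits.kernel.lift_ι,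
      F.kernel_comp_map_syzygyMap_eq (ProjectiveResolution.liftIdHomotopy B (R B)) i,
      ProjectiveResolution.syzygyMap_id, Functor.map_id, Category.comp_id, Category.id_comp]
  map_comp {X Y Z} f g := by
    rw [← cancel_mono (Limits.kernel.ι _), Limits.kernel.lift_ι,
      F.kernel_comp_map_syzygyMap_eq
        (ProjectiveResolution.liftCompHomotopy f g (R X) (R Y) (R Z)) i,
      ProjectiveResolution.syzygyMap_comp, Functor.map_comp]
    simp

set_option linter.unusedSectionVars false in
theorem leftSatelliteSucc_map_ι (i : ℕ) {B B' : 𝒜} (f : B ⟶ B') :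
    (leftSatelliteSucc F R i).map f ≫ Limits.kernel.ι (F.map ((R B').syzygyι i)) =
      Limits.kernel.ι (F.map ((R B).syzygyι i)) ≫
        F.map (ProjectiveResolution.syzygyMap (ProjectiveResolution.lift f (R B) (R B')) (i + 1)) :=
  Limits.kernel.lift_ι _ _ _

/-- The map `S_{i+1} F ⟶ F̲ ∘ Ω^{i+1}`: the inclusion of `S_{i+1} F B` in `F (Ω^{i+1} B)` followed by
the projection onto the quot-stabilization. -/
noncomputable def satelliteToQuotStabSyzygy (i : ℕ) :
    leftSatelliteSucc F R i ⟶ quotStabSyzygy F R (i + 1) where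
  app B := Limits.kernel.ι (F.map ((R B).syzygyι i)) ≫ F.toQuotStab.app ((R B).syzygy (i + 1))
  naturality B B' f := by
    simp [leftSatelliteSucc, quotStabSyzygy]

/-- The map `L_{i+1} F ⟶ S_{i+1} F`. -/
noncomputable def leftDerivedToSatellite (i : ℕ) :
    F.leftDerived (i + 1) ⟶ leftSatelliteSucc F R i where
  app B := ((R B).isoLeftDerivedObj F (i + 1)).hom ≫ F.homologyToSatellite (R B) i
  naturality B B' f := by
    have h := ProjectiveResolution.isoLeftDerivedObj_hom_naturality f (R B) (R B')
      (ProjectiveResolution.lift f (R B) (R B'))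
      (ProjectiveResolution.lift_commutes_zero f (R B) (R B')) F (i + 1)
    have h' : HomologicalComplex.homologyMap
        (F.mapResolutionMap (ProjectiveResolution.lift f (R B) (R B'))) (i + 1) ≫ F.homologyToSatellite (R B') i =
        F.homologyToSatellite (R B) i ≫ (leftSatelliteSucc F R i).map f := by
      refine (cancel_mono (Limits.kernel.ι (F.map ((R B').syzygyι i)))).1 ?_
      have e : HomologicalComplex.homologyMap
          (F.mapResolutionMap (ProjectiveResolution.lift f (R B) (R B'))) (i + 1) ≫
            F.homologyToSatellite (R B') i ≫ Limits.kernel.ι (F.map ((R B').syzygyι i)) =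
          (F.homologyToSatellite (R B) i ≫ Limits.kernel.ι (F.map ((R B).syzygyι i))) ≫
            F.map (ProjectiveResolution.syzygyMap
              (ProjectiveResolution.lift f (R B) (R B')) (i + 1)) := by
        rw [homologyToSatellite_ι, homologyToSatellite_ι,
          HomologicalComplex.homologyι_naturality_assoc, opcyclesToMapSyzygy_naturality,
          Category.assoc]
      exact (Category.assoc _ _ _).trans (e.trans ((Category.assoc _ _ _).trans
        ((congrArg (F.homologyToSatellite (R B) i ≫ ·)
          (leftSatelliteSucc_map_ι F R i f).symm).trans (Category.assoc _ _ _).symm)))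
    exact comp_eq_of_squares h h'

/-- The map `F̲ (Ω^{i+1} B) ⟶ H_i(F P)` induced by `F (Ω^{i+1} B) ⟶ F (P_i)`. -/
noncomputable def quotStabToHomology {B : 𝒜} (P : ProjectiveResolution B) (i : ℕ) :
    F.quotStab.obj (P.syzygy (i + 1)) ⟶ (F.mapResolution P).homology i :=
  cokernel.desc _ (F.mapSyzygyToCycles P i ≫ (F.mapResolution P).homologyπ i)
    (F.fromLeftDerivedZero_comp_eq_zero (P.toSyzygy (i + 1)) inferInstance _
      (F.mapToSyzygy_mapSyzygyToCycles_homologyπ P i))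

theorem toQuotStab_quotStabToHomology {B : 𝒜} (P : ProjectiveResolution B) (i : ℕ) :
    F.toQuotStab.app (P.syzygy (i + 1)) ≫ F.quotStabToHomology P i =
      F.mapSyzygyToCycles P i ≫ (F.mapResolution P).homologyπ i :=
  cokernel.π_desc _ _ _

/-- The map `F̲ ∘ Ω^{i+1} ⟶ L_i F`. -/
noncomputable def quotStabSyzygyToLeftDerived (i : ℕ) :
    quotStabSyzygy F R (i + 1) ⟶ F.leftDerived i where
  app B := F.quotStabToHomology (R B) i ≫ ((R B).isoLeftDerivedObj F i).inv
  naturality B B' f := by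
    have h := ProjectiveResolution.isoLeftDerivedObj_inv_naturality f (R B) (R B')
      (ProjectiveResolution.lift f (R B) (R B'))
      (ProjectiveResolution.lift_commutes_zero f (R B) (R B')) F i
    have h' : (quotStabSyzygy F R (i + 1)).map f ≫ F.quotStabToHomology (R B') i =
        F.quotStabToHomology (R B) i ≫
          HomologicalComplex.homologyMap
            (F.mapResolutionMap (ProjectiveResolution.lift f (R B) (R B'))) i := by
      refine (cancel_epi (F.toQuotStab.app ((R B).syzygy (i + 1)))).1 ?_
      dsimp only [quotStabSyzygy]
      rw [← NatTrans.naturality_assoc, toQuotStab_quotStabToHomology, ← Category.assoc,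
        ← mapSyzygyToCycles_naturality, Category.assoc,
        ← HomologicalComplex.homologyπ_naturality, ← Category.assoc (F.toQuotStab.app _),
        toQuotStab_quotStabToHomology, Category.assoc]
    exact comp_eq_of_squares h' h.symm

/-- The left satellites `S_i F`, with the convention `S₀ F = F`. -/
noncomputable def leftSatellite : ℕ → 𝒜 ⥤ ℬ
  | 0 => F
  | i + 1 => leftSatelliteSucc F R i

/-- The functors `F̲ ∘ Ωⁱ`, with `F̲ ∘ Ω⁰ = F̲`. -/
noncomputable def quotStabOmega : ℕ → 𝒜 ⥤ ℬ
  | 0 => F.quotStab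
  | i + 1 => quotStabSyzygy F R (i + 1)

end CategoryTheory.Functor

/-- Maps forming a long sequence
`⋯ ⟶ Q₂ ⟶ L₁ ⟶ S₁ ⟶ Q₁ ⟶ L₀ ⟶ S₀ ⟶ Q₀ ⟶ 0` with the given terms. -/
structure LongSequence {𝒟 : Type u} [Category.{v} 𝒟] (L S Q : ℕ → 𝒟) where
  /-- `L_i ⟶ S_i` -/
  l : ∀ i, L i ⟶ S i
  /-- `S_i ⟶ Q_i` -/
  s : ∀ i, S i ⟶ Q i
  /-- `Q_{i+1} ⟶ L_i` -/
  q : ∀ i, Q (i + 1) ⟶ L i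

/-- Exactness of a long sequence at every term, including `Q₀`. -/
structure LongSequence.Exact {𝒟 : Type u} [Category.{v} 𝒟] [Abelian 𝒟] {L S Q : ℕ → 𝒟}
    (T : LongSequence L S Q) : Prop where
  exact_S : ∀ i, ∃ w : T.l i ≫ T.s i = 0, (ShortComplex.mk (T.l i) (T.s i) w).Exact
  exact_L : ∀ i, ∃ w : T.q i ≫ T.l i = 0, (ShortComplex.mk (T.q i) (T.l i) w).Exact
  exact_Q : ∀ i, ∃ w : T.s (i + 1) ≫ T.q i = 0, (ShortComplex.mk (T.s (i + 1)) (T.q i) w).Exact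
  epi : Epi (T.s 0)

/-- An isomorphism of long sequences. -/
structure LongSequence.Iso {𝒟 : Type u} [Category.{v} 𝒟] {L S Q L' S' Q' : ℕ → 𝒟}
    (T : LongSequence L S Q) (T' : LongSequence L' S' Q') where
  isoL : ∀ i, L i ≅ L' i
  isoS : ∀ i, S i ≅ S' i
  isoQ : ∀ i, Q i ≅ Q' i
  comm_l : ∀ i, T.l i ≫ (isoS i).hom = (isoL i).hom ≫ T'.l i
  comm_s : ∀ i, T.s i ≫ (isoQ i).hom = (isoS i).hom ≫ T'.s i
  comm_q : ∀ i, T.q i ≫ (isoL i).hom = (isoQ (i + 1)).hom ≫ T'.q i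

/-- The left fundamental sequence
`⋯ ⟶ F̲ ∘ Ω² ⟶ L₁F ⟶ S₁F ⟶ F̲ ∘ Ω ⟶ L₀F ⟶ F ⟶ F̲ ⟶ 0` of an additive functor `F`,
computed with the projective resolutions `R`. -/
noncomputable def leftFundamentalSequence [HasProjectiveResolutions 𝒜] (F : 𝒜 ⥤ ℬ) [F.Additive]
    (R : ∀ B : 𝒜, ProjectiveResolution B) :
    LongSequence F.leftDerived (F.leftSatellite R) (F.quotStabOmega R) where
  l
    | 0 => F.fromLeftDerivedZero
    | i + 1 => F.leftDerivedToSatellite R i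
  s
    | 0 => F.toQuotStab
    | i + 1 => F.satelliteToQuotStabSyzygy R i
  q i := F.quotStabSyzygyToLeftDerived R i

end LeftFundamentalSequence

/-! ### Tensor products over an arbitrary ring, flatness, Tor -/

section BalancedTensor

variable (Λ : Type u) [Ring Λ]

/-- The relations `aλ ⊗ b = a ⊗ λb` in `A ⊗_ℤ B`. A right `Λ`-module is a module over `Λᵐᵒᵖ`, with
`aλ = op λ • a`. -/
def balancedRelations (A : Type v) [AddCommGroup A] [Module Λᵐᵒᵖ A] (B : Type v') [AddCommGroup B]
    [Module Λ B] : AddSubgroup (A ⊗[ℤ] B) :=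
  AddSubgroup.closure
    {t | ∃ (a : A) (r : Λ) (b : B), t = (MulOpposite.op r • a) ⊗ₜ[ℤ] b - a ⊗ₜ[ℤ] (r • b)}

/-- The tensor product `A ⊗_Λ B` of a right and a left `Λ`-module, an abelian group. -/
abbrev BalancedTensor (A : Type v) [AddCommGroup A] [Module Λᵐᵒᵖ A] (B : Type v') [AddCommGroup B]
    [Module Λ B] : Type (max v v') :=
  (A ⊗[ℤ] B) ⧸ balancedRelations Λ A B

variable {A A' A'' : Type v} [AddCommGroup A] [Module Λᵐᵒᵖ A] [AddCommGroup A'] [Module Λᵐᵒᵖ A']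
  [AddCommGroup A''] [Module Λᵐᵒᵖ A'']
  {B B' B'' : Type v'} [AddCommGroup B] [Module Λ B] [AddCommGroup B'] [Module Λ B']
  [AddCommGroup B''] [Module Λ B'']

namespace BalancedTensor

/-- The pure tensor `a ⊗ b` in `A ⊗_Λ B`. -/
def tmul (a : A) (b : B) : BalancedTensor Λ A B :=
  QuotientAddGroup.mk (a ⊗ₜ[ℤ] b)

variable {Λ}

theorem addHom_ext {G : Type*} [AddCommGroup G] {f g : BalancedTensor Λ A B →+ G}
    (h : ∀ a b, f (tmul Λ a b) = g (tmul Λ a b)) : f = g := by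
  refine QuotientAddGroup.addMonoidHom_ext _ ?_
  ext t
  induction t using TensorProduct.induction_on with
  | zero => simp
  | tmul a b => exact h a b
  | add x y hx hy => rw [map_add, map_add, hx, hy]

/-- The homomorphism `f ⊗ g : A ⊗_Λ B → A' ⊗_Λ B'`. -/
def map (f : A →ₗ[Λᵐᵒᵖ] A') (g : B →ₗ[Λ] B') :
    BalancedTensor Λ A B →+ BalancedTensor Λ A' B' :=
  QuotientAddGroup.map _ _
    (TensorProduct.map f.toAddMonoidHom.toIntLinearMap g.toAddMonoidHom.toIntLinearMap).toAddMonoidHom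
    (by
      rw [balancedRelations, AddSubgroup.closure_le]
      rintro _ ⟨a, r, b, rfl⟩
      refine AddSubgroup.subset_closure ⟨f a, r, g b, ?_⟩
      simp)

@[simp]
theorem map_tmul (f : A →ₗ[Λᵐᵒᵖ] A') (g : B →ₗ[Λ] B') (a : A) (b : B) :
    map f g (tmul Λ a b) = tmul Λ (f a) (g b) :=
  rfl

theorem tmul_add (a : A) (b b' : B) : tmul Λ a (b + b') = tmul Λ a b + tmul Λ a b' := by
  simp [tmul, TensorProduct.tmul_add]

theorem add_tmul (a a' : A) (b : B) : tmul Λ (a + a') b = tmul Λ a b + tmul Λ a' b := by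
  simp [tmul, TensorProduct.add_tmul]

end BalancedTensor

end BalancedTensor

section Tensor

variable (Λ : Type u) [Ring Λ]

/-- The bifunctor `(A, B) ↦ A ⊗_Λ B`. -/
def tensorBifunctor : ModuleCat.{v} Λᵐᵒᵖ ⥤ ModuleCat.{v} Λ ⥤ AddCommGrpCat.{v} where
  obj A :=
    { obj := fun B => AddCommGrpCat.of (BalancedTensor Λ A B)
      map := fun g => AddCommGrpCat.ofHom (BalancedTensor.map LinearMap.id g.hom)
      map_id := fun B => by
        ext1
        exact BalancedTensor.addHom_ext fun a b => rfl
      map_comp := fun f g => by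
        ext1
        exact BalancedTensor.addHom_ext fun a b => rfl }
  map f :=
    { app := fun B => AddCommGrpCat.ofHom (BalancedTensor.map f.hom LinearMap.id)
      naturality := fun B B' g => by
        ext1
        exact BalancedTensor.addHom_ext fun a b => rfl }
  map_id A := by
    ext B : 2
    ext1
    exact BalancedTensor.addHom_ext fun a b => rfl
  map_comp f g := by
    ext B : 2
    ext1
    exact BalancedTensor.addHom_ext fun a b => rfl

variable {Λ}

/-- The functor `A ⊗_Λ -` on left modules. -/
abbrev tensorWith (A : ModuleCat.{v} Λᵐᵒᵖ) : ModuleCat.{v} Λ ⥤ AddCommGrpCat.{v} :=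
  (tensorBifunctor Λ).obj A

/-- The functor `- ⊗_Λ B` on right modules. -/
abbrev tensorOn (B : ModuleCat.{v} Λ) : ModuleCat.{v} Λᵐᵒᵖ ⥤ AddCommGrpCat.{v} :=
  (tensorBifunctor Λ).flip.obj B

instance additive_tensorWith (A : ModuleCat.{v} Λᵐᵒᵖ) : (tensorWith A).Additive where
  map_add {B B' f g} := by
    ext1
    exact BalancedTensor.addHom_ext fun a b => BalancedTensor.tmul_add a (f.hom b) (g.hom b)

instance additive_tensorOn (B : ModuleCat.{v} Λ) : (tensorOn B).Additive where
  map_add {A A' f g} := by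
    ext1
    exact BalancedTensor.addHom_ext fun a b => BalancedTensor.add_tmul (f.hom a) (g.hom a) b

/-- A right module `A` is flat if `A ⊗_Λ -` preserves injections. -/
def IsFlatRight (A : ModuleCat.{v} Λᵐᵒᵖ) : Prop :=
  ∀ ⦃B B' : ModuleCat.{v} Λ⦄ (f : B ⟶ B'), Function.Injective f →
    Function.Injective ((tensorWith A).map f)

/-- `Tor_i^Λ(A, -)`, the `i`-th left derived functor of `A ⊗_Λ -`. -/
noncomputable def torFunctor [Small.{v} Λ] (A : ModuleCat.{v} Λᵐᵒᵖ) (i : ℕ) :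
    ModuleCat.{v} Λ ⥤ AddCommGrpCat.{v} :=
  (tensorWith A).leftDerived i

/-- The functor `B ↦ C ⊗_Λ B` from left modules to complexes of abelian groups. -/
noncomputable def tensorComplex (C : ChainComplex (ModuleCat.{v} Λᵐᵒᵖ) ℤ) :
    ModuleCat.{v} Λ ⥤ ChainComplex AddCommGrpCat.{v} ℤ where
  obj B := ((tensorOn B).mapHomologicalComplex (ComplexShape.down ℤ)).obj C
  map g := (NatTrans.mapHomologicalComplex ((tensorBifunctor Λ).flip.map g)
    (ComplexShape.down ℤ)).app C
  map_id B := by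
    ext i : 1
    exact ((tensorBifunctor Λ).obj (C.X i)).map_id B
  map_comp f g := by
    ext i : 1
    exact ((tensorBifunctor Λ).obj (C.X i)).map_comp f g

instance additive_tensorComplex (C : ChainComplex (ModuleCat.{v} Λᵐᵒᵖ) ℤ) :
    (tensorComplex C).Additive where
  map_add {B B' f g} := by
    ext i : 1
    exact (tensorWith (C.X i)).map_add

/-- The functor `H_n(C ⊗_Λ -)` on left modules. -/
noncomputable def tensorHomology (C : ChainComplex (ModuleCat.{v} Λᵐᵒᵖ) ℤ) (n : ℤ) :
    ModuleCat.{v} Λ ⥤ AddCommGrpCat.{v} :=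
  tensorComplex C ⋙ HomologicalComplex.homologyFunctor AddCommGrpCat.{v} (ComplexShape.down ℤ) n

instance additive_tensorHomology (C : ChainComplex (ModuleCat.{v} Λᵐᵒᵖ) ℤ) (n : ℤ) :
    (tensorHomology C n).Additive :=
  inferInstanceAs (tensorComplex C ⋙ HomologicalComplex.homologyFunctor _ _ n).Additive

/-- The map `Z_n(C) ⊗_Λ B ⟶ Z_n(C ⊗_Λ B)`, `z ⊗ b ↦ z ⊗ b`. -/
noncomputable def cyclesTensor (C : ChainComplex (ModuleCat.{v} Λᵐᵒᵖ) ℤ) (n : ℤ)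
    (B : ModuleCat.{v} Λ) :
    (tensorOn B).obj (C.cycles n) ⟶ ((tensorComplex C).obj B).cycles n :=
  HomologicalComplex.liftCycles ((tensorComplex C).obj B) ((tensorOn B).map (C.iCycles n))
    _ rfl (by
      have : (tensorOn B).map (C.iCycles n) ≫
          (tensorOn B).map (C.d n ((ComplexShape.down ℤ).next n)) = 0 := by
        rw [← Functor.map_comp, HomologicalComplex.iCycles_d, Functor.map_zero]
      exact this)

/-- `κ : H_n(C) ⊗_Λ - ⟶ H_n(C ⊗_Λ -)` is the canonical natural transformation:
`κ ([z] ⊗ b) = [z ⊗ b]` for every cycle `z` of `C`. -/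
def IsHomologyTensorMap (C : ChainComplex (ModuleCat.{v} Λᵐᵒᵖ) ℤ) (n : ℤ)
    (κ : tensorWith (C.homology n) ⟶ tensorHomology C n) : Prop :=
  ∀ B : ModuleCat.{v} Λ, (tensorOn B).map (C.homologyπ n) ≫ κ.app B =
    cyclesTensor C n B ≫ ((tensorComplex C).obj B).homologyπ n

/-- The terms `H_n(C) ⊗ -, Tor₁(H_n(C), -), Tor₂(H_n(C), -), …`. -/
noncomputable def uctHomologyTerm [Small.{v} Λ] (C : ChainComplex (ModuleCat.{v} Λᵐᵒᵖ) ℤ) (n : ℤ) :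
    ℕ → ModuleCat.{v} Λ ⥤ AddCommGrpCat.{v}
  | 0 => tensorWith (C.homology n)
  | i + 1 => torFunctor (C.homology n) (i + 1)

/-- The terms `H_n(C ⊗ -), Tor₁(C_n/B_n, -), Tor₂(C_n/B_n, -), …`; here `C.opcycles n` is
`C_n/B_n`, the cokernel of `C_{n+1} ⟶ C_n`. -/
noncomputable def uctSatelliteTerm [Small.{v} Λ] (C : ChainComplex (ModuleCat.{v} Λᵐᵒᵖ) ℤ) (n : ℤ) :
    ℕ → ModuleCat.{v} Λ ⥤ AddCommGrpCat.{v}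
  | 0 => tensorHomology C n
  | i + 1 => torFunctor (C.opcycles n) (i + 1)

/-- The terms `Tor₁(C_{n-1}/B_{n-1}, -), Tor₂(C_{n-1}/B_{n-1}, -), …`. -/
noncomputable def uctQuotStabTerm [Small.{v} Λ] (C : ChainComplex (ModuleCat.{v} Λᵐᵒᵖ) ℤ) (n : ℤ)
    (i : ℕ) : ModuleCat.{v} Λ ⥤ AddCommGrpCat.{v} :=
  torFunctor (C.opcycles (n - 1)) (i + 1)

end Tensor

/-! Everything follows from one exact sequence of functors `0 ⟶ F ⟶ G ⟶ E ⟶ G' ⟶ 0`, with `F = H_n(C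
⊗ -)`, `G = (C_n/B_n) ⊗ -`, `E = C_{n-1} ⊗ -` and `G' = (C_{n-1}/B_{n-1}) ⊗ -`
(`tensorHomologyFourTermExact`). Here `G` and `G'` are right exact, and `E` is exact because
`C_{n-1}` is flat.

Since `G` is right exact and `E` preserves monomorphisms, a diagram chase shows that `F` is half
exact (`FourTermExact.isHalfExact`), and the left fundamental sequence of a half exact functor is
exact (`IsHalfExact.leftFundamentalSequence_exact`).

The terms are then identified one kind at a time. Satellites: an element of `G(Ω^{i+1}B)` that dies
in `G(P_i)` dies in `E(Ω^{i+1}B)`, hence lies in `F(Ω^{i+1}B)`; so `F` and `G` have the same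
satellites, and those of the right exact `G` are its derived functors. Quot-stabilization: the snake
lemma for `0 ⟶ Ω^{i+1}B ⟶ P_i ⟶ Ωⁱ B ⟶ 0` identifies the cokernel of `F(P_i) ⟶ F(Ωⁱ B)`, which is
`F̲(Ωⁱ B)`, with the kernel of `G'(Ω^{i+1}B) ⟶ G'(P_i)`, which is `L_{i+1}G'(B)`. Derived functors:
projective left modules are flat, so `κ` is an isomorphism on them (`isIso_homologyTensor_app`) and
`L_i κ` is an isomorphism for every `i`.

The Tor sequence is the fundamental sequence transported along these isomorphisms, so it is exact
and isomorphic to it by construction. It remains to see that `λ_F` is transported to `κ`, which is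
naturality of `λ` in the functor. -/

section LongExactness

variable {𝒜 : Type u} [Category.{v} 𝒜] {ℬ : Type u'} [Category.{v'} ℬ] [Abelian ℬ]

/-! ### Exactness of sequences of functors, tested objectwise -/

namespace CategoryTheory

/-- A short complex of functors is exact if it is exact objectwise. -/
theorem ShortComplex.exact_of_app (S : ShortComplex (𝒜 ⥤ ℬ))
    (h : ∀ X, (S.map ((evaluation 𝒜 ℬ).obj X)).Exact) : S.Exact := by
  rw [ShortComplex.exact_iff_isZero_homology, Functor.isZero_iff]
  intro X
  exact ((ShortComplex.exact_iff_isZero_homology _).1 (h X)).of_iso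
    (S.mapHomologyIso ((evaluation 𝒜 ℬ).obj X)).symm

theorem ShortComplex.exact_mk_of_app {F G H : 𝒜 ⥤ ℬ} (f : F ⟶ G) (g : G ⟶ H)
    (h : ∀ X, ∃ w : f.app X ≫ g.app X = 0, (ShortComplex.mk (f.app X) (g.app X) w).Exact) :
    ∃ w : f ≫ g = 0, (ShortComplex.mk f g w).Exact :=
  ⟨NatTrans.ext (funext fun X => (h X).1), ShortComplex.exact_of_app _ fun X => (h X).2⟩

/-- Diagram chases in an abelian category: a morphism into `Y` serves as an element, and a preimage
need only exist after pulling back along an epimorphism. -/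
theorem ShortComplex.exact_mk_of_refinements {X Y Z : ℬ} {f : X ⟶ Y} {g : Y ⟶ Z} (w : f ≫ g = 0)
    (h : ∀ ⦃A : ℬ⦄ (y : A ⟶ Y), y ≫ g = 0 →
      ∃ (A' : ℬ) (π : A' ⟶ A) (_ : Epi π) (x : A' ⟶ X), π ≫ y = x ≫ f) :
    ∃ w : f ≫ g = 0, (ShortComplex.mk f g w).Exact :=
  ⟨w, (ShortComplex.exact_iff_exact_up_to_refinements _).2 h⟩

theorem ShortComplex.exact_mk_of_iso {X Y Z X' Y' Z' : ℬ} {f : X ⟶ Y} {g : Y ⟶ Z} {f' : X' ⟶ Y'}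
    {g' : Y' ⟶ Z'} (eX : X ≅ X') (eY : Y ≅ Y') (eZ : Z ≅ Z') (hf : f ≫ eY.hom = eX.hom ≫ f')
    (hg : g ≫ eZ.hom = eY.hom ≫ g') (h : ∃ w : f ≫ g = 0, (ShortComplex.mk f g w).Exact) :
    ∃ w : f' ≫ g' = 0, (ShortComplex.mk f' g' w).Exact := by
  obtain ⟨w, h⟩ := h
  have w' : f' ≫ g' = 0 := by
    rw [← cancel_epi eX.hom, ← Category.assoc, ← hf, Category.assoc, ← hg, ← Category.assoc, w,
      zero_comp, comp_zero]
  exact ⟨w', ShortComplex.exact_of_iso (S₁ := ShortComplex.mk f g w)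
    (S₂ := ShortComplex.mk f' g' w') (ShortComplex.isoMk eX eY eZ hf.symm hg.symm) h⟩

/-- This variant and the next two absorb the isomorphism `isoLeftDerivedObj` at the left, middle or
right term, according to the place of `L_i F` in the three-term piece considered. -/
theorem ShortComplex.exact_mk_iso_comp {X X' Y Z : ℬ} {f : X ⟶ Y} {g : Y ⟶ Z} (e : X' ≅ X)
    (h : ∃ w : f ≫ g = 0, (ShortComplex.mk f g w).Exact) :
    ∃ w : (e.hom ≫ f) ≫ g = 0, (ShortComplex.mk (e.hom ≫ f) g w).Exact :=
  exact_mk_of_iso e.symm (Iso.refl _) (Iso.refl _) (by simp) (by simp) h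

theorem ShortComplex.exact_mk_iso_middle {X Y Y' Z : ℬ} {f : X ⟶ Y} {g : Y ⟶ Z} (e : Y' ≅ Y)
    (h : ∃ w : f ≫ g = 0, (ShortComplex.mk f g w).Exact) :
    ∃ w : (f ≫ e.inv) ≫ e.hom ≫ g = 0, (ShortComplex.mk (f ≫ e.inv) (e.hom ≫ g) w).Exact :=
  exact_mk_of_iso (Iso.refl _) e.symm (Iso.refl _) (by simp) (by simp) h

theorem ShortComplex.exact_mk_comp_iso {X Y Z Z' : ℬ} {f : X ⟶ Y} {g : Y ⟶ Z} (e : Z ≅ Z')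
    (h : ∃ w : f ≫ g = 0, (ShortComplex.mk f g w).Exact) :
    ∃ w : f ≫ g ≫ e.hom = 0, (ShortComplex.mk f (g ≫ e.hom) w).Exact :=
  exact_mk_of_iso (Iso.refl _) (Iso.refl _) e (by simp) (by simp) h

variable [Abelian 𝒜]

/-! ### The left fundamental sequence of a half exact functor is exact -/

namespace Functor

/-- A functor is half exact if it is exact in the middle on short exact sequences. -/
def IsHalfExact (F : 𝒜 ⥤ ℬ) [F.Additive] : Prop :=
  ∀ S : ShortComplex 𝒜, S.ShortExact → (S.map F).Exact

section

variable (F : 𝒜 ⥤ ℬ) [F.Additive] {B : 𝒜} (P : ProjectiveResolution B)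

/-- The rule for evaluating on homology classes in the chases below: the class of a cycle `x` in
`F(P_{i+1})` goes to the image of `x` in `F(Ω^{i+1}B)`. -/
theorem homologyToSatellite_eq_liftCycles (i : ℕ) {A : ℬ} (x : A ⟶ (F.mapResolution P).X (i + 1))
    (hx : x ≫ (F.mapResolution P).d (i + 1) i = 0) :
    ((F.mapResolution P).liftCycles x i (by simp) hx ≫ (F.mapResolution P).homologyπ (i + 1)) ≫
      F.homologyToSatellite P i ≫ Limits.kernel.ι (F.map (P.syzygyι i)) =
      x ≫ F.mapToSyzygy P (i + 1) := by
  rw [homologyToSatellite_ι, Category.assoc, HomologicalComplex.homology_π_ι_assoc,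
    HomologicalComplex.liftCycles_i_assoc, pOpcycles_opcyclesToMapSyzygy]

end

variable [HasProjectiveResolutions 𝒜] (F : 𝒜 ⥤ ℬ) [F.Additive]

theorem map_comp_toQuotStab {Q X : 𝒜} [Projective Q] (p : Q ⟶ X) :
    F.map p ≫ F.toQuotStab.app X = 0 := by
  rw [F.toQuotStab.naturality, (F.isZero_quotStab_obj Q).eq_zero_of_tgt (F.toQuotStab.app Q),
    zero_comp]

/-- For an epimorphism `p : Q ⟶ X` from a projective object, the quot-stabilization of `F` at `X`
is the cokernel of `F Q ⟶ F X`. -/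
theorem exact_map_toQuotStab {Q X : 𝒜} [Projective Q] (p : Q ⟶ X) [Epi p] :
    (ShortComplex.mk (F.map p) (F.toQuotStab.app X) (F.map_comp_toQuotStab p)).Exact := by
  refine ShortComplex.exact_of_g_is_cokernel _
    (CokernelCofork.IsColimit.ofπ' _ _ fun g w => ?_)
  -- A map out of `F X` that kills `F Q` also kills the image of `L₀F X`, so it factors through the
  -- cokernel defining `F̲ X`.
  exact ⟨cokernel.desc _ g (F.fromLeftDerivedZero_comp_eq_zero p inferInstance g w),
    cokernel.π_desc _ _ _⟩

section

variable {B : 𝒜} (P : ProjectiveResolution B)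

/-- An element of the satellite that vanishes in `F̲(Ω^{i+1}B)` lifts to `F(P_{i+1})`. The lift is a
cycle because the element dies in `F(P_i)`, and its class is the preimage. Half exactness plays no
role here. -/
theorem exact_homologyToSatellite (i : ℕ) :
    ∃ w : F.homologyToSatellite P i ≫ Limits.kernel.ι (F.map (P.syzygyι i)) ≫
      F.toQuotStab.app (P.syzygy (i + 1)) = 0, (ShortComplex.mk _ _ w).Exact := by
  have hd : F.mapToSyzygy P (i + 1) ≫ F.toQuotStab.app (P.syzygy (i + 1)) = 0 :=
    F.map_comp_toQuotStab (P.toSyzygy (i + 1))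
  refine ShortComplex.exact_mk_of_refinements ?_ fun A y hy => ?_
  · rw [← Category.assoc, homologyToSatellite_ι,
      ← cancel_epi ((F.mapResolution P).homologyπ (i + 1)), Category.assoc,
      HomologicalComplex.homology_π_ι_assoc, ← Category.assoc (HomologicalComplex.pOpcycles _ _),
      pOpcycles_opcyclesToMapSyzygy, hd, comp_zero, comp_zero]
  · rw [← Category.assoc] at hy
    obtain ⟨A', π, hπ, x, hx⟩ :=
      (F.exact_map_toQuotStab (P.toSyzygy (i + 1))).exact_up_to_refinements _ hy
    let x' : A' ⟶ (F.mapResolution P).X (i + 1) := x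
    have hx' : π ≫ y ≫ Limits.kernel.ι (F.map (P.syzygyι i)) = x' ≫ F.mapToSyzygy P (i + 1) := hx
    have hxd : x' ≫ (F.mapResolution P).d (i + 1) i = 0 := by
      rw [← mapToSyzygy_mapSyzygyι, ← Category.assoc, ← hx', Category.assoc, Category.assoc]
      have : Limits.kernel.ι (F.map (P.syzygyι i)) ≫ F.mapSyzygyι P i = 0 :=
        Limits.kernel.condition _
      rw [this, comp_zero, comp_zero]
    refine ⟨A', π, hπ, (F.mapResolution P).liftCycles x' i (by simp) hxd ≫
      (F.mapResolution P).homologyπ (i + 1), ?_⟩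
    rw [← cancel_mono (Limits.kernel.ι (F.map (P.syzygyι i))), Category.assoc, hx',
      Category.assoc _ (F.homologyToSatellite P i), F.homologyToSatellite_eq_liftCycles]

/-- Represent `y` by `z` in `F(Ω^{i+1}B)`. If its image in `F(P_i)` is the boundary of `x`, then `z`
minus the image of `x` lies in the satellite and still represents `y`, because `F(P_{i+1})` dies in
`F̲(Ω^{i+1}B)`. -/
theorem exact_quotStabToHomology (i : ℕ) :
    ∃ w : (Limits.kernel.ι (F.map (P.syzygyι i)) ≫ F.toQuotStab.app (P.syzygy (i + 1))) ≫
      F.quotStabToHomology P i = 0, (ShortComplex.mk _ _ w).Exact := by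
  have hk : Limits.kernel.ι (F.map (P.syzygyι i)) ≫ F.mapSyzygyι P i = 0 :=
    Limits.kernel.condition _
  have hk' : Limits.kernel.ι (F.map (P.syzygyι i)) ≫ F.mapSyzygyToCycles P i = 0 := by
    rw [← cancel_mono ((F.mapResolution P).iCycles i), Category.assoc,
      mapSyzygyToCycles_iCycles, hk, zero_comp]
  refine ShortComplex.exact_mk_of_refinements ?_ fun A y hy => ?_
  · rw [Category.assoc, toQuotStab_quotStabToHomology, ← Category.assoc, hk', zero_comp]
  · obtain ⟨A₁, π₁, hπ₁, z, hz⟩ :=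
      surjective_up_to_refinements_of_epi (F.toQuotStab.app (P.syzygy (i + 1))) y
    have hz' : (z ≫ F.mapSyzygyToCycles P i) ≫ (F.mapResolution P).homologyπ i = 0 := by
      rw [Category.assoc, ← toQuotStab_quotStabToHomology, ← Category.assoc, ← hz, Category.assoc,
        hy, comp_zero]
    obtain ⟨A₂, π₂, hπ₂, x, hx⟩ :=
      (HomologicalComplex.comp_homologyπ_eq_zero_iff_up_to_refinements
        _ (i + 1) _ (by simp) _).1 hz'
    have hx' : π₂ ≫ z ≫ F.mapSyzygyι P i =
        (x ≫ F.mapToSyzygy P (i + 1)) ≫ F.mapSyzygyι P i := by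
      rw [Category.assoc, mapToSyzygy_mapSyzygyι, ← HomologicalComplex.toCycles_i,
        ← Category.assoc x, ← hx, Category.assoc, Category.assoc, mapSyzygyToCycles_iCycles]
    have hd : F.mapToSyzygy P (i + 1) ≫ F.toQuotStab.app (P.syzygy (i + 1)) = 0 :=
      F.map_comp_toQuotStab (P.toSyzygy (i + 1))
    have hs : (π₂ ≫ z - x ≫ F.mapToSyzygy P (i + 1)) ≫ F.map (P.syzygyι i) = 0 := by
      rw [Preadditive.sub_comp, sub_eq_zero, Category.assoc]
      exact hx'
    refine ⟨A₂, π₂ ≫ π₁, inferInstance, Limits.kernel.lift _ _ hs, ?_⟩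
    rw [Limits.kernel.lift_ι_assoc, Preadditive.sub_comp, Category.assoc, Category.assoc,
      Category.assoc, hd, comp_zero, sub_zero, hz]

variable {F}

/-- Half exactness enters the fundamental sequence here: a cycle of `F(P_i)` that dies in `F(Ωⁱ B)`
comes from `F(Ω^{i+1}B)`. The target index `j` is left free so as to cover degree `0`, where `next 0
= 0`, together with positive degrees. -/
theorem IsHalfExact.exact_toQuotStab_quotStabToHomology (hF : F.IsHalfExact) (i : ℕ)
    {A : ℬ} (x : A ⟶ (F.mapResolution P).X i) (j : ℕ) (hj : (ComplexShape.down ℕ).next i = j)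
    (hx : x ≫ (F.mapResolution P).d i j = 0) (hx0 : x ≫ F.mapToSyzygy P i = 0) :
    ∃ (A' : ℬ) (π : A' ⟶ A) (_ : Epi π) (z : A' ⟶ F.quotStab.obj (P.syzygy (i + 1))),
      π ≫ (F.mapResolution P).liftCycles x j hj hx ≫ (F.mapResolution P).homologyπ i =
        z ≫ F.quotStabToHomology P i := by
  obtain ⟨A₂, π₂, hπ₂, z, hz⟩ := (hF _ (P.syzygy_shortExact i)).exact_up_to_refinements x hx0
  let z' : A₂ ⟶ F.obj (P.syzygy (i + 1)) := z
  have hz' : π₂ ≫ x = z' ≫ F.mapSyzygyι P i := hz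
  refine ⟨A₂, π₂, inferInstance, z' ≫ F.toQuotStab.app (P.syzygy (i + 1)), ?_⟩
  rw [Category.assoc, toQuotStab_quotStabToHomology, ← Category.assoc, ← Category.assoc z']
  congr 1
  rw [← cancel_mono ((F.mapResolution P).iCycles i), Category.assoc, Category.assoc,
    HomologicalComplex.liftCycles_i, mapSyzygyToCycles_iCycles, hz']

theorem IsHalfExact.exact_quotStabToHomology_homologyToSatellite (hF : F.IsHalfExact) (i : ℕ) :
    ∃ w : F.quotStabToHomology P (i + 1) ≫ F.homologyToSatellite P i = 0,
      (ShortComplex.mk _ _ w).Exact := by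
  have hcomp : F.mapSyzygyι P (i + 1) ≫ F.mapToSyzygy P (i + 1) = 0 := by
    have : F.map (P.syzygyι (i + 1)) ≫ F.map (P.toSyzygy (i + 1)) = 0 := by
      rw [← F.map_comp, ProjectiveResolution.syzygyι_toSyzygy, F.map_zero]
    exact this
  refine ShortComplex.exact_mk_of_refinements ?_ fun A y hy => ?_
  · rw [← cancel_epi (F.toQuotStab.app (P.syzygy (i + 2))),
      ← cancel_mono (Limits.kernel.ι (F.map (P.syzygyι i))), comp_zero, zero_comp,
      ← Category.assoc (F.toQuotStab.app _),
      toQuotStab_quotStabToHomology, Category.assoc, Category.assoc,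
      homologyToSatellite_ι, HomologicalComplex.homology_π_ι_assoc, ← Category.assoc,
      mapSyzygyToCycles_iCycles, pOpcycles_opcyclesToMapSyzygy, hcomp]
  · obtain ⟨A₁, π₁, hπ₁, x, hx, hxy⟩ :=
      (F.mapResolution P).eq_liftCycles_homologyπ_up_to_refinements y i (by simp)
    have hx0 : x ≫ F.mapToSyzygy P (i + 1) = 0 := by
      rw [← F.homologyToSatellite_eq_liftCycles P i x hx, ← hxy, Category.assoc,
        ← Category.assoc y, hy, zero_comp, comp_zero]
    obtain ⟨A₂, π₂, hπ₂, z, hz⟩ :=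
      hF.exact_toQuotStab_quotStabToHomology P (i + 1) x i (by simp) hx hx0
    exact ⟨A₂, π₂ ≫ π₁, inferInstance, z, by rw [Category.assoc, hxy, hz]⟩

theorem IsHalfExact.exact_quotStabToHomology_fromLeftDerivedZero' (hF : F.IsHalfExact) :
    ∃ w : F.quotStabToHomology P 0 ≫
        (ChainComplex.isoHomologyι₀ (F.mapResolution P)).hom ≫ P.fromLeftDerivedZero' F = 0,
      (ShortComplex.mk _ _ w).Exact := by
  have hπ : (P.toSyzygy 0 ≫ P.syzygyZeroIso.hom : P.complex.X 0 ⟶ B) = P.π.f 0 :=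
    (P.complex.opcyclesIsCokernel 1 0 (by simp)).comp_coconePointUniqueUpToIso_hom
      P.isColimitCokernelCofork WalkingParallelPair.one
  have hπ' : F.mapToSyzygy P 0 ≫ F.map P.syzygyZeroIso.hom =
      (F.mapResolution P).pOpcycles 0 ≫ P.fromLeftDerivedZero' F := by
    rw [P.pOpcycles_comp_fromLeftDerivedZero' F]
    exact (F.map_comp _ _).symm.trans (congrArg F.map hπ)
  -- On degree `0` classes, `L₀F ⟶ F` is `F(P₀) ⟶ F(Ω⁰ B) ≅ F(B)`. This places exactness at `L₀F`
  -- within reach of the same chase as in higher degrees.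
  have key : (F.mapResolution P).homologyπ 0 ≫
      (ChainComplex.isoHomologyι₀ (F.mapResolution P)).hom ≫ P.fromLeftDerivedZero' F =
      (F.mapResolution P).iCycles 0 ≫ F.mapToSyzygy P 0 ≫ F.map P.syzygyZeroIso.hom := by
    rw [hπ', ← HomologicalComplex.homology_π_ι_assoc]
    rfl
  have hcomp : F.mapSyzygyι P 0 ≫ F.mapToSyzygy P 0 = 0 := by
    have : F.map (P.syzygyι 0) ≫ F.map (P.toSyzygy 0) = 0 := by
      rw [← F.map_comp, ProjectiveResolution.syzygyι_toSyzygy, F.map_zero]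
    exact this
  refine ShortComplex.exact_mk_of_refinements ?_ fun A y hy => ?_
  · rw [← cancel_epi (F.toQuotStab.app (P.syzygy 1)), comp_zero, ← Category.assoc,
      toQuotStab_quotStabToHomology, Category.assoc, key, ← Category.assoc,
      mapSyzygyToCycles_iCycles, ← Category.assoc, hcomp, zero_comp]
  · obtain ⟨A₁, π₁, hπ₁, x, hx, hxy⟩ :=
      (F.mapResolution P).eq_liftCycles_homologyπ_up_to_refinements y 0 (by simp)
    have hx0 : x ≫ F.mapToSyzygy P 0 = 0 := by
      rw [← cancel_mono (F.map P.syzygyZeroIso.hom), zero_comp, Category.assoc,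
        ← HomologicalComplex.liftCycles_i (F.mapResolution P) x 0 (by simp) hx, Category.assoc,
        ← key, ← Category.assoc, ← hxy, Category.assoc, hy, comp_zero]
    obtain ⟨A₂, π₂, hπ₂, z, hz⟩ :=
      hF.exact_toQuotStab_quotStabToHomology P 0 x 0 (by simp) hx hx0
    exact ⟨A₂, π₂ ≫ π₁, inferInstance, z, by rw [Category.assoc, hxy, hz]⟩

end

/-- The left fundamental sequence of a half exact functor is exact. -/
theorem IsHalfExact.leftFundamentalSequence_exact {F : 𝒜 ⥤ ℬ} [F.Additive] (hF : F.IsHalfExact)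
    (R : ∀ B : 𝒜, ProjectiveResolution B) : (leftFundamentalSequence F R).Exact where
  exact_S
    | 0 => ShortComplex.exact_mk_of_app _ _ fun B =>
        ⟨cokernel.condition _, ShortComplex.exact_cokernel _⟩
    | i + 1 => ShortComplex.exact_mk_of_app _ _ fun B =>
        ShortComplex.exact_mk_iso_comp ((R B).isoLeftDerivedObj F (i + 1))
          (F.exact_homologyToSatellite (R B) i)
  exact_L
    | 0 => ShortComplex.exact_mk_of_app _ _ fun B => by
        have := ShortComplex.exact_mk_iso_middle ((R B).isoLeftDerivedObj F 0)
          (hF.exact_quotStabToHomology_fromLeftDerivedZero' (R B))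
        -- The map `L₀F ⟶ F` can be computed with any resolution; here with the given `R B`.
        have e := (R B).fromLeftDerivedZero_eq F
        change ∃ w : _ ≫ F.fromLeftDerivedZero.app B = 0,
          (ShortComplex.mk _ (F.fromLeftDerivedZero.app B) w).Exact
        rw [e]
        exact this
    | i + 1 => ShortComplex.exact_mk_of_app _ _ fun B =>
        ShortComplex.exact_mk_iso_middle ((R B).isoLeftDerivedObj F (i + 1))
          (hF.exact_quotStabToHomology_homologyToSatellite (R B) i)
  exact_Q i := ShortComplex.exact_mk_of_app _ _ fun B =>
    ShortComplex.exact_mk_comp_iso ((R B).isoLeftDerivedObj F i).symm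
      (F.exact_quotStabToHomology (R B) i)
  epi := by
    rw [NatTrans.epi_iff_epi_app]
    exact fun B => F.epi_toQuotStab_app B

end Functor

end CategoryTheory

end LongExactness

/-! ### Transport of long sequences -/

section LongSequenceTransport

variable {𝒟 : Type u} [Category.{v} 𝒟] {L S Q L' S' Q' : ℕ → 𝒟}

/-- Transport of a long sequence along isomorphisms of its terms. -/
def LongSequence.ofIso (T : LongSequence L S Q) (eL : ∀ i, L i ≅ L' i) (eS : ∀ i, S i ≅ S' i)
    (eQ : ∀ i, Q i ≅ Q' i) : LongSequence L' S' Q' where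
  l i := (eL i).inv ≫ T.l i ≫ (eS i).hom
  s i := (eS i).inv ≫ T.s i ≫ (eQ i).hom
  q i := (eQ (i + 1)).inv ≫ T.q i ≫ (eL i).hom

/-- The isomorphism from a long sequence to its transport. -/
def LongSequence.isoOfIso (T : LongSequence L S Q) (eL : ∀ i, L i ≅ L' i)
    (eS : ∀ i, S i ≅ S' i) (eQ : ∀ i, Q i ≅ Q' i) : T.Iso (T.ofIso eL eS eQ) where
  isoL := eL
  isoS := eS
  isoQ := eQ
  comm_l i := by simp [LongSequence.ofIso]
  comm_s i := by simp [LongSequence.ofIso]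
  comm_q i := by simp [LongSequence.ofIso]

theorem LongSequence.Exact.of_iso [Abelian 𝒟] {T : LongSequence L S Q}
    {T' : LongSequence L' S' Q'} (hT : T.Exact) (e : T.Iso T') : T'.Exact where
  exact_S i := ShortComplex.exact_mk_of_iso (e.isoL i) (e.isoS i) (e.isoQ i) (e.comm_l i)
    (e.comm_s i) (hT.exact_S i)
  exact_L i := ShortComplex.exact_mk_of_iso (e.isoQ (i + 1)) (e.isoL i) (e.isoS i) (e.comm_q i)
    (e.comm_l i) (hT.exact_L i)
  exact_Q i := ShortComplex.exact_mk_of_iso (e.isoS (i + 1)) (e.isoQ (i + 1)) (e.isoL i)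
    (e.comm_s (i + 1)) (e.comm_q i) (hT.exact_Q i)
  epi := by
    have := hT.epi
    have h : Epi ((e.isoS 0).hom ≫ T'.s 0) := by
      rw [← e.comm_s 0]
      infer_instance
    exact epi_of_epi (e.isoS 0).hom _

end LongSequenceTransport

/-! ### Derived functors and satellites of natural transformations -/

section Satellites

variable {𝒜 : Type u} [Category.{v} 𝒜] [Abelian 𝒜] {ℬ : Type u'} [Category.{v'} ℬ] [Abelian ℬ]

namespace CategoryTheory

theorem ProjectiveResolution.leftDerived_app_comp_hom {F G : 𝒜 ⥤ ℬ} [F.Additive] [G.Additive]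
    [HasProjectiveResolutions 𝒜] (α : F ⟶ G) {X : 𝒜} (P : ProjectiveResolution X) (n : ℕ) :
    (NatTrans.leftDerived α n).app X ≫ (P.isoLeftDerivedObj G n).hom =
      (P.isoLeftDerivedObj F n).hom ≫ (HomologicalComplex.homologyFunctor ℬ _ n).map
        ((NatTrans.mapHomologicalComplex α _).app P.complex) := by
  rw [P.leftDerived_app_eq α n, Category.assoc, Category.assoc, Iso.inv_hom_id, Category.comp_id]

/-- A natural transformation that is an isomorphism on projective objects induces isomorphisms on
left derived functors. -/
theorem NatTrans.isIso_leftDerived [HasProjectiveResolutions 𝒜] {F G : 𝒜 ⥤ ℬ} [F.Additive]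
    [G.Additive] (α : F ⟶ G) (hα : ∀ (P : 𝒜) [Projective P], IsIso (α.app P)) (n : ℕ) :
    IsIso (NatTrans.leftDerived α n) := by
  rw [NatTrans.isIso_iff_isIso_app]
  intro X
  let P := projectiveResolution X
  have : IsIso ((NatTrans.mapHomologicalComplex α (ComplexShape.down ℕ)).app P.complex) := by
    have (i : ℕ) : IsIso
        (((NatTrans.mapHomologicalComplex α (ComplexShape.down ℕ)).app P.complex).f i) :=
      hα (P.complex.X i)
    exact HomologicalComplex.Hom.isIso_of_components _
  rw [P.leftDerived_app_eq α n]
  infer_instance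

/-- Naturality of `λ_F` in `F`, which reduces to naturality of `α` at the augmentation `P₀ ⟶ X`.
Applied to `κ`, it identifies `λ_F` with `κ`, since `λ` is invertible for the right exact functor
`H_n(C) ⊗ -`. -/
theorem NatTrans.leftDerived_zero_comp_fromLeftDerivedZero [HasProjectiveResolutions 𝒜]
    {F G : 𝒜 ⥤ ℬ} [F.Additive] [G.Additive] (α : F ⟶ G) :
    NatTrans.leftDerived α 0 ≫ G.fromLeftDerivedZero = F.fromLeftDerivedZero ≫ α := by
  ext X
  let P := projectiveResolution X
  let a := (NatTrans.mapHomologicalComplex α (ComplexShape.down ℕ)).app P.complex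
  have h1 : HomologicalComplex.opcyclesMap a 0 ≫ P.fromLeftDerivedZero' G =
      P.fromLeftDerivedZero' F ≫ α.app X := by
    rw [← cancel_epi (HomologicalComplex.pOpcycles _ _), HomologicalComplex.p_opcyclesMap_assoc,
      P.pOpcycles_comp_fromLeftDerivedZero' G, ← Category.assoc,
      P.pOpcycles_comp_fromLeftDerivedZero' F]
    exact (α.naturality (P.π.f 0)).symm
  have h2 : HomologicalComplex.homologyMap a 0 ≫
      (ChainComplex.isoHomologyι₀ (G.mapResolution P)).hom ≫ P.fromLeftDerivedZero' G =
      (ChainComplex.isoHomologyι₀ (F.mapResolution P)).hom ≫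
        P.fromLeftDerivedZero' F ≫ α.app X := by
    rw [← h1]
    exact HomologicalComplex.homologyι_naturality_assoc a 0 _
  have h3 := P.leftDerived_app_comp_hom α 0
  have h4 := P.fromLeftDerivedZero_eq F
  have h5 := P.fromLeftDerivedZero_eq G
  rw [NatTrans.comp_app, NatTrans.comp_app, h4, h5]
  exact comp_eq_of_squares h3 (h2.trans (Category.assoc _ _ _).symm)

namespace Functor

/-! ### Satellites of right exact functors -/

section RightExact

variable (G : 𝒜 ⥤ ℬ) [G.Additive] [PreservesFiniteColimits G]

/-- Both sides are cokernels of `G(P_{i+1}) ⟶ G(P_i)`, because `G` preserves cokernels. -/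
theorem isIso_opcyclesToMapSyzygy {B : 𝒜} (P : ProjectiveResolution B) (i : ℕ) :
    IsIso (G.opcyclesToMapSyzygy P i) := by
  have h1 := (G.mapResolution P).opcyclesIsCokernel (i + 1) i (by simp)
  have h2 := isColimitCoforkMapOfIsColimit' G _ (P.complex.opcyclesIsCokernel (i + 1) i (by simp))
  have : G.opcyclesToMapSyzygy P i = (h1.coconePointUniqueUpToIso h2).hom := by
    rw [← cancel_epi ((G.mapResolution P).pOpcycles i), pOpcycles_opcyclesToMapSyzygy]
    exact (h1.comp_coconePointUniqueUpToIso_hom h2 WalkingParallelPair.one).symm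
  rw [this]
  infer_instance

/-- Homology in degree `i + 1` is the kernel of the map from the opcycles to `G(P_i)`. By
`isIso_opcyclesToMapSyzygy` these opcycles are `G(Ω^{i+1}B)`, so this kernel is the satellite. -/
theorem isIso_homologyToSatellite {B : 𝒜} (P : ProjectiveResolution B) (i : ℕ) :
    IsIso (G.homologyToSatellite P i) := by
  have := G.isIso_opcyclesToMapSyzygy P (i + 1)
  have hm : Mono (G.homologyToSatellite P i) := by
    have : Mono (G.homologyToSatellite P i ≫ kernel.ι (G.map (P.syzygyι i))) := by
      rw [homologyToSatellite_ι]
      infer_instance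
    exact mono_of_mono _ (kernel.ι (G.map (P.syzygyι i)))
  have hk : (kernel.ι (G.map (P.syzygyι i)) ≫
      CategoryTheory.inv (G.opcyclesToMapSyzygy P (i + 1))) ≫
      (G.mapResolution P).fromOpcycles (i + 1) i = 0 := by
    rw [← opcyclesToMapSyzygy_comp, Category.assoc, IsIso.inv_hom_id_assoc]
    exact kernel.condition _
  let l := KernelFork.IsLimit.lift'
    ((G.mapResolution P).homologyIsKernel (i + 1) i (by simp)) _ hk
  have hl : l.1 ≫ (G.mapResolution P).homologyι (i + 1) = _ := l.2
  have hs : l.1 ≫ G.homologyToSatellite P i = 𝟙 _ := by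
    rw [← cancel_mono (kernel.ι (G.map (P.syzygyι i))), Category.assoc, homologyToSatellite_ι,
      ← Category.assoc, hl, Category.assoc, IsIso.inv_hom_id, Category.comp_id, Category.id_comp]
  have : IsSplitEpi (G.homologyToSatellite P i) := ⟨⟨_, hs⟩⟩
  exact isIso_of_mono_of_isSplitEpi _

/-- The higher left derived functors of a right exact functor are its left satellites. -/
theorem isIso_leftDerivedToSatellite [HasProjectiveResolutions 𝒜]
    (R : ∀ B : 𝒜, ProjectiveResolution B) (i : ℕ) : IsIso (G.leftDerivedToSatellite R i) := by
  rw [NatTrans.isIso_iff_isIso_app]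
  intro B
  have := G.isIso_homologyToSatellite (R B) i
  exact IsIso.comp_isIso' (f := ((R B).isoLeftDerivedObj G (i + 1)).hom) inferInstance this

/-- `L_{i+1} G ≅ S_{i+1} G` for a right exact functor `G`. -/
noncomputable def leftDerivedIsoSatellite [HasProjectiveResolutions 𝒜]
    (R : ∀ B : 𝒜, ProjectiveResolution B) (i : ℕ) :
    G.leftDerived (i + 1) ≅ leftSatelliteSucc G R i :=
  have := G.isIso_leftDerivedToSatellite R i
  asIso (G.leftDerivedToSatellite R i)

end RightExact

/-- The map induced on left satellites by a natural transformation. -/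
noncomputable def leftSatelliteSuccMap {F G : 𝒜 ⥤ ℬ} [F.Additive] [G.Additive] (α : F ⟶ G)
    (R : ∀ B : 𝒜, ProjectiveResolution B) (i : ℕ) :
    leftSatelliteSucc F R i ⟶ leftSatelliteSucc G R i where
  app B := kernel.map _ _ (α.app _) (α.app _) (α.naturality _)
  naturality B B' f := by
    dsimp only [leftSatelliteSucc]
    rw [← cancel_mono (kernel.ι (G.map ((R B').syzygyι i)))]
    simp

theorem leftSatelliteSuccMap_app_ι {F G : 𝒜 ⥤ ℬ} [F.Additive] [G.Additive] (α : F ⟶ G)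
    (R : ∀ B : 𝒜, ProjectiveResolution B) (i : ℕ) (B : 𝒜) :
    (leftSatelliteSuccMap α R i).app B ≫ kernel.ι (G.map ((R B).syzygyι i)) =
      kernel.ι (F.map ((R B).syzygyι i)) ≫ α.app ((R B).syzygy (i + 1)) :=
  kernel.lift_ι _ _ _

variable (F : 𝒜 ⥤ ℬ) [F.Additive]

/-- `F̲ ∘ Ω⁰ ≅ F̲`. -/
noncomputable def quotStabSyzygyZeroIso [HasProjectiveResolutions 𝒜]
    (R : ∀ B : 𝒜, ProjectiveResolution B) : quotStabSyzygy F R 0 ≅ F.quotStab :=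
  NatIso.ofComponents (fun B => F.quotStab.mapIso (R B).syzygyZeroIso) fun {B B'} f => by
    have hπ (X : 𝒜) : (R X).toSyzygy 0 ≫ (R X).syzygyZeroIso.hom = (R X).π.f 0 :=
      ((R X).complex.opcyclesIsCokernel 1 0 (by simp)).comp_coconePointUniqueUpToIso_hom
        (R X).isColimitCokernelCofork WalkingParallelPair.one
    have h : ProjectiveResolution.syzygyMap (ProjectiveResolution.lift f (R B) (R B')) 0 ≫
        (R B').syzygyZeroIso.hom = (R B).syzygyZeroIso.hom ≫ f := by
      rw [← cancel_epi ((R B).toSyzygy 0), ← Category.assoc,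
        ProjectiveResolution.toSyzygy_syzygyMap, Category.assoc, hπ, ← Category.assoc, hπ]
      exact ProjectiveResolution.lift_commutes_zero f (R B) (R B')
    exact (F.quotStab.map_comp _ _).symm.trans
      ((congrArg F.quotStab.map h).trans (F.quotStab.map_comp _ _))

end Functor

/-! ### Consequences of a four-term exact sequence of functors -/

/-- An exact sequence `0 ⟶ F ⟶ G ⟶ E ⟶ G' ⟶ 0` of functors. -/
structure FourTermExact (F G E G' : 𝒜 ⥤ ℬ) where
  /-- the first map -/
  i : F ⟶ G
  /-- the second map -/
  p : G ⟶ E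
  /-- the third map -/
  q : E ⟶ G'
  i_p : ∀ X, i.app X ≫ p.app X = 0
  p_q : ∀ X, p.app X ≫ q.app X = 0
  mono_i : ∀ X, Mono (i.app X)
  exact_i_p : ∀ X, (ShortComplex.mk (i.app X) (p.app X) (i_p X)).Exact
  exact_p_q : ∀ X, (ShortComplex.mk (p.app X) (q.app X) (p_q X)).Exact
  epi_q : ∀ X, Epi (q.app X)

namespace FourTermExact

attribute [instance] mono_i epi_q

variable {F G E G' : 𝒜 ⥤ ℬ} [F.Additive] [G.Additive] (T : FourTermExact F G E G')

section

variable [E.PreservesMonomorphisms]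

/-- An element of `G(Ω^{i+1}B)` killed in `G(P_i)` has image in `E(Ω^{i+1}B)` killed in `E(P_i)`,
hence zero since `E` preserves monomorphisms. So it lies in `F(Ω^{i+1}B)`, and it dies in `F(P_i)`
because `F ⟶ G` is a monomorphism. -/
theorem isIso_leftSatelliteSuccMap (R : ∀ B : 𝒜, ProjectiveResolution B) (i : ℕ) :
    IsIso (Functor.leftSatelliteSuccMap T.i R i) := by
  rw [NatTrans.isIso_iff_isIso_app]
  intro B
  let m : kernel (F.map ((R B).syzygyι i)) ⟶ kernel (G.map ((R B).syzygyι i)) :=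
    (Functor.leftSatelliteSuccMap T.i R i).app B
  have : Mono ((R B).syzygyι i) := ((R B).syzygy_shortExact i).mono_f
  have hm : m ≫ kernel.ι (G.map ((R B).syzygyι i)) = kernel.ι (F.map ((R B).syzygyι i)) ≫
      T.i.app ((R B).syzygy (i + 1)) := Functor.leftSatelliteSuccMap_app_ι T.i R i B
  have : Mono m := by
    have : Mono (m ≫ kernel.ι (G.map ((R B).syzygyι i))) := by
      rw [hm]
      have := T.mono_i ((R B).syzygy (i + 1))
      exact mono_comp _ _
    exact mono_of_mono _ (kernel.ι (G.map ((R B).syzygyι i)))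
  have hx : kernel.ι (G.map ((R B).syzygyι i)) ≫ T.p.app _ = 0 := by
    rw [← cancel_mono (E.map ((R B).syzygyι i)), Category.assoc, ← T.p.naturality,
      kernel.condition_assoc, zero_comp, zero_comp]
  let l := (T.exact_i_p ((R B).syzygy (i + 1))).lift _ hx
  have hl : l ≫ T.i.app _ = kernel.ι (G.map ((R B).syzygyι i)) :=
    (T.exact_i_p ((R B).syzygy (i + 1))).lift_f _ hx
  have hl' : l ≫ F.map ((R B).syzygyι i) = 0 := by
    rw [← cancel_mono (T.i.app _), Category.assoc, T.i.naturality, ← Category.assoc, hl,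
      kernel.condition, zero_comp]
  have hs : kernel.lift _ l hl' ≫ m = 𝟙 _ := by
    rw [← cancel_mono (kernel.ι (G.map ((R B).syzygyι i))), Category.assoc, hm,
      kernel.lift_ι_assoc, hl, Category.id_comp]
  have : IsSplitEpi m := ⟨⟨_, hs⟩⟩
  exact isIso_of_mono_of_isSplitEpi m

/-- The kernel of a map from a right exact functor to a functor preserving monomorphisms is half
exact. -/
theorem isHalfExact (T : FourTermExact F G E G') [PreservesFiniteColimits G] : F.IsHalfExact := by
  intro S hS
  have := hS.mono_f
  have := hS.epi_g
  have hG : (S.map G).Exact :=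
    hS.exact.map_of_epi_of_preservesCokernel G inferInstance inferInstance
  rw [ShortComplex.exact_iff_exact_up_to_refinements]
  intro A x (hx : x ≫ F.map S.g = 0)
  change A ⟶ F.obj S.X₂ at x
  obtain ⟨A', π, hπ, y, hy⟩ := hG.exact_up_to_refinements (x ≫ T.i.app S.X₂) (by
    change (x ≫ T.i.app S.X₂) ≫ G.map S.g = 0
    rw [Category.assoc, ← T.i.naturality, ← Category.assoc]
    exact (congrArg (· ≫ T.i.app S.X₃) hx).trans zero_comp)
  change A' ⟶ G.obj S.X₁ at y
  change π ≫ x ≫ T.i.app S.X₂ = y ≫ G.map S.f at hy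
  -- The image of `y` in `E(X₁)` vanishes because it vanishes in `E(X₂)`, where it is the image of
  -- an element of `F(X₂)`. Hence `y` comes from `F(X₁)`.
  have hy' : y ≫ T.p.app S.X₁ = 0 := by
    rw [← cancel_mono (E.map S.f), Category.assoc, ← T.p.naturality, ← Category.assoc, ← hy,
      Category.assoc, Category.assoc, T.i_p, comp_zero, comp_zero, zero_comp]
  refine ⟨A', π, hπ, (T.exact_i_p S.X₁).lift y hy', ?_⟩
  change π ≫ x = _ ≫ F.map S.f
  have hl : (T.exact_i_p S.X₁).lift y hy' ≫ T.i.app S.X₁ = y :=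
    (T.exact_i_p S.X₁).lift_f y hy'
  rw [← cancel_mono (T.i.app S.X₂), Category.assoc, hy, Category.assoc, T.i.naturality,
    ← Category.assoc, hl]

end

/-! ### The snake lemma and the quot-stabilization on syzygies -/

variable [E.Additive] [G'.Additive] [PreservesFiniteColimits G] [PreservesFiniteLimits E]

/-- The snake diagram with rows `F`, `G`, `E`, `G'` applied to a short exact sequence. -/
noncomputable def snakeInput (S : ShortComplex 𝒜) (hS : S.ShortExact) :
    ShortComplex.SnakeInput ℬ where
  L₀ := S.map F
  L₁ := S.map G
  L₂ := S.map E
  L₃ := S.map G'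
  v₀₁ := S.mapNatTrans T.i
  v₁₂ := S.mapNatTrans T.p
  v₂₃ := S.mapNatTrans T.q
  w₀₂ := by
    ext
    exacts [T.i_p _, T.i_p _, T.i_p _]
  w₁₃ := by
    ext
    exacts [T.p_q _, T.p_q _, T.p_q _]
  h₀ := by
    apply ShortComplex.isLimitOfIsLimitπ
    all_goals
      exact (KernelFork.isLimitMapConeEquiv _ _).symm (T.exact_i_p _).fIsKernel
  h₃ := by
    apply ShortComplex.isColimitOfIsColimitπ
    all_goals
      exact (CokernelCofork.isColimitMapCoconeEquiv _ _).symm (T.exact_p_q _).gIsCokernel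
  L₁_exact := by
    have := hS.epi_g
    exact hS.exact.map_of_epi_of_preservesCokernel G inferInstance inferInstance
  epi_L₁_g := by
    have := hS.epi_g
    exact inferInstanceAs (Epi (G.map S.g))
  L₂_exact := by
    have := hS.mono_f
    exact hS.exact.map_of_mono_of_preservesKernel E inferInstance inferInstance
  mono_L₂_f := by
    have := hS.mono_f
    exact inferInstanceAs (Mono (E.map S.f))

/-- Functoriality of the snake diagram in the short exact sequence. -/
noncomputable def snakeInputMap {S S' : ShortComplex 𝒜} (hS : S.ShortExact) (hS' : S'.ShortExact)
    (φ : S ⟶ S') : T.snakeInput S hS ⟶ T.snakeInput S' hS' where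
  f₀ := F.mapShortComplex.map φ
  f₁ := G.mapShortComplex.map φ
  f₂ := E.mapShortComplex.map φ
  f₃ := G'.mapShortComplex.map φ
  comm₀₁ := by
    ext
    exacts [T.i.naturality _, T.i.naturality _, T.i.naturality _]
  comm₁₂ := by
    ext
    exacts [T.p.naturality _, T.p.naturality _, T.p.naturality _]
  comm₂₃ := by
    ext
    exacts [T.q.naturality _, T.q.naturality _, T.q.naturality _]

variable {B : 𝒜} (P : ProjectiveResolution B)

/-- The connecting homomorphism `F (Ωⁱ B) ⟶ G' (Ω^{i+1} B)`. -/
noncomputable def connecting (i : ℕ) : F.obj (P.syzygy i) ⟶ G'.obj (P.syzygy (i + 1)) :=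
  (T.snakeInput _ (P.syzygy_shortExact i)).δ

theorem connecting_map_syzygyι (i : ℕ) : T.connecting P i ≫ G'.map (P.syzygyι i) = 0 :=
  (T.snakeInput _ (P.syzygy_shortExact i)).δ_L₃_f

/-- The connecting homomorphism as a map to the satellite of `G'`. -/
noncomputable def connectingToKernel (i : ℕ) :
    F.obj (P.syzygy i) ⟶ kernel (G'.map (P.syzygyι i)) :=
  kernel.lift _ (T.connecting P i) (T.connecting_map_syzygyι P i)

theorem connectingToKernel_ι (i : ℕ) :
    T.connectingToKernel P i ≫ kernel.ι (G'.map (P.syzygyι i)) = T.connecting P i :=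
  kernel.lift_ι _ _ _

theorem connectingToKernel_naturality {B' : 𝒜} {P : ProjectiveResolution B}
    {P' : ProjectiveResolution B'} (φ : P.complex ⟶ P'.complex) (i : ℕ) :
    F.map (ProjectiveResolution.syzygyMap (P := P) (P' := P') φ i) ≫ T.connecting P' i =
      T.connecting P i ≫
        G'.map (ProjectiveResolution.syzygyMap (P := P) (P' := P') φ (i + 1)) := by
  let ψ : ShortComplex.mk _ _ (P.syzygyι_toSyzygy i) ⟶
      ShortComplex.mk _ _ (P'.syzygyι_toSyzygy i) :=
    { τ₁ := ProjectiveResolution.syzygyMap (P := P) (P' := P') φ (i + 1)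
      τ₂ := φ.f i
      τ₃ := ProjectiveResolution.syzygyMap (P := P) (P' := P') φ i
      comm₁₂ := (ProjectiveResolution.syzygyι_naturality φ i).symm
      comm₂₃ := (ProjectiveResolution.toSyzygy_syzygyMap φ i).symm }
  exact (ShortComplex.SnakeInput.naturality_δ
    (T.snakeInputMap (P.syzygy_shortExact i) (P'.syzygy_shortExact i) ψ)).symm

/-- Exactness of the snake sequence at `G'(Ω^{i+1}B)`. -/
theorem epi_connectingToKernel (i : ℕ) : Epi (T.connectingToKernel P i) :=
  (T.snakeInput _ (P.syzygy_shortExact i)).L₂'_exact.epi_kernelLift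

theorem map_toSyzygy_connectingToKernel (i : ℕ) :
    F.map (P.toSyzygy i) ≫ T.connectingToKernel P i = 0 := by
  rw [← cancel_mono (kernel.ι (G'.map (P.syzygyι i))), Category.assoc, connectingToKernel_ι,
    zero_comp]
  exact (T.snakeInput _ (P.syzygy_shortExact i)).L₀_g_δ

/-- Exactness of the snake sequence at `F(Ωⁱ B)`. With `epi_connectingToKernel`, it makes the kernel
of `G'(Ω^{i+1}B) ⟶ G'(P_i)` a cokernel of `F(P_i) ⟶ F(Ωⁱ B)`, as `F̲(Ωⁱ B)` is. -/
theorem exact_connectingToKernel (i : ℕ) :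
    (ShortComplex.mk _ _ (T.map_toSyzygy_connectingToKernel P i)).Exact := by
  rw [ShortComplex.exact_iff_exact_up_to_refinements]
  intro A x (hx : x ≫ T.connectingToKernel P i = 0)
  refine (T.snakeInput _ (P.syzygy_shortExact i)).L₁'_exact.exact_up_to_refinements x ?_
  change x ≫ T.connecting P i = 0
  rw [← connectingToKernel_ι, ← Category.assoc, hx, zero_comp]

variable [HasProjectiveResolutions 𝒜]

/-- `F̲ (Ωⁱ B) ≅ ker (G' (Ω^{i+1} B) ⟶ G' (P_i))`. -/
noncomputable def quotStabIsoKernel (i : ℕ) :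
    F.quotStab.obj (P.syzygy i) ≅ kernel (G'.map (P.syzygyι i)) :=
  have := T.epi_connectingToKernel P i
  (F.exact_map_toQuotStab (P.toSyzygy i)).gIsCokernel.coconePointUniqueUpToIso
    (T.exact_connectingToKernel P i).gIsCokernel

theorem toQuotStab_quotStabIsoKernel_hom (i : ℕ) :
    F.toQuotStab.app (P.syzygy i) ≫ (T.quotStabIsoKernel P i).hom = T.connectingToKernel P i :=
  have := T.epi_connectingToKernel P i
  (F.exact_map_toQuotStab (P.toSyzygy i)).gIsCokernel.comp_coconePointUniqueUpToIso_hom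
    (T.exact_connectingToKernel P i).gIsCokernel WalkingParallelPair.one

/-- `F̲ ∘ Ωⁱ ≅ S_{i+1} G'`. -/
noncomputable def quotStabSyzygyIsoSatellite (R : ∀ B : 𝒜, ProjectiveResolution B) (i : ℕ) :
    Functor.quotStabSyzygy F R i ≅ Functor.leftSatelliteSucc G' R i :=
  NatIso.ofComponents (fun B => T.quotStabIsoKernel (R B) i) fun {B B'} f => by
    dsimp only [Functor.quotStabSyzygy, Functor.leftSatelliteSucc]
    rw [← cancel_epi (F.toQuotStab.app ((R B).syzygy i)),
      ← cancel_mono (kernel.ι (G'.map ((R B').syzygyι i)))]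
    simp only [Category.assoc]
    rw [← NatTrans.naturality_assoc, ← Category.assoc (F.toQuotStab.app _),
      toQuotStab_quotStabIsoKernel_hom, connectingToKernel_ι, kernel.lift_ι,
      ← Category.assoc (F.toQuotStab.app _), toQuotStab_quotStabIsoKernel_hom,
      ← Category.assoc (T.connectingToKernel _ _), connectingToKernel_ι]
    exact T.connectingToKernel_naturality _ i

variable [PreservesFiniteColimits G']

/-- `F̲ ∘ Ωⁱ ≅ L_{i+1} G'`. -/
noncomputable def quotStabOmegaIso (R : ∀ B : 𝒜, ProjectiveResolution B) :
    ∀ i, F.quotStabOmega R i ≅ G'.leftDerived (i + 1)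
  -- The fundamental sequence ends in `F̲` itself, whereas the snake lemma speaks of `F̲(Ω⁰ B)`;
  -- hence the extra isomorphism in degree `0`.
  | 0 => (F.quotStabSyzygyZeroIso R).symm ≪≫ T.quotStabSyzygyIsoSatellite R 0 ≪≫
      (G'.leftDerivedIsoSatellite R 0).symm
  | i + 1 => T.quotStabSyzygyIsoSatellite R (i + 1) ≪≫
      (G'.leftDerivedIsoSatellite R (i + 1)).symm

/-- `S_{i+1} F ≅ L_{i+1} G`. -/
noncomputable def satelliteIso (R : ∀ B : 𝒜, ProjectiveResolution B) (i : ℕ) :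
    Functor.leftSatelliteSucc F R i ≅ G.leftDerived (i + 1) :=
  have := T.isIso_leftSatelliteSuccMap R i
  asIso (Functor.leftSatelliteSuccMap T.i R i) ≪≫ (G.leftDerivedIsoSatellite R i).symm

end FourTermExact

end CategoryTheory

end Satellites

/-! ### Exactness properties of the balanced tensor product -/

section BalancedTensorExactness

variable {Λ : Type u} [Ring Λ]
variable {A A' A'' : Type v} [AddCommGroup A] [Module Λᵐᵒᵖ A] [AddCommGroup A'] [Module Λᵐᵒᵖ A']
  [AddCommGroup A''] [Module Λᵐᵒᵖ A'']
  {B B' B'' : Type v'} [AddCommGroup B] [Module Λ B] [AddCommGroup B'] [Module Λ B']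
  [AddCommGroup B''] [Module Λ B'']

namespace BalancedTensor

theorem map_surjective {f : A →ₗ[Λᵐᵒᵖ] A'} {g : B →ₗ[Λ] B'} (hf : Function.Surjective f)
    (hg : Function.Surjective g) : Function.Surjective (map f g) := by
  intro x
  obtain ⟨t, rfl⟩ := QuotientAddGroup.mk_surjective x
  have h : Function.Surjective (TensorProduct.map f.toAddMonoidHom.toIntLinearMap
      g.toAddMonoidHom.toIntLinearMap) := TensorProduct.map_surjective hf hg
  obtain ⟨s, rfl⟩ := h t
  exact ⟨QuotientAddGroup.mk s, rfl⟩

theorem tmul_zero (a : A) : tmul Λ a (0 : B) = 0 :=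
  (AddMonoidHom.mk' (tmul Λ a) (tmul_add (B := B) a)).map_zero

theorem zero_tmul (b : B) : tmul Λ (0 : A) b = 0 :=
  (AddMonoidHom.mk' (fun a : A => tmul Λ a b) fun a a' => add_tmul a a' b).map_zero

/-- Relations in the target of a tensor product of surjections lift. -/
theorem exists_balancedRelations_eq {f : A →ₗ[Λᵐᵒᵖ] A'} {g : B →ₗ[Λ] B'}
    (hf : Function.Surjective f) (hg : Function.Surjective g) {t : A' ⊗[ℤ] B'}
    (ht : t ∈ balancedRelations Λ A' B') :
    ∃ s ∈ balancedRelations Λ A B,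
      TensorProduct.map f.toAddMonoidHom.toIntLinearMap g.toAddMonoidHom.toIntLinearMap s = t := by
  suffices h : balancedRelations Λ A' B' ≤ (balancedRelations Λ A B).map
      (TensorProduct.map f.toAddMonoidHom.toIntLinearMap
        g.toAddMonoidHom.toIntLinearMap).toAddMonoidHom from h ht
  rw [balancedRelations, AddSubgroup.closure_le]
  rintro _ ⟨a', r, b', rfl⟩
  obtain ⟨a, rfl⟩ := hf a'
  obtain ⟨b, rfl⟩ := hg b'
  exact ⟨_, AddSubgroup.subset_closure ⟨a, r, b, rfl⟩, by simp⟩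

/-- Deduced from right exactness over `ℤ`. A representative `t` of a kernel element maps to a
balanced relation, which lifts to a relation `s` as `g` is surjective. Then `t - s` dies in the
tensor product over `ℤ`, so it comes from `A ⊗_ℤ B`. The proof of `map_exact_right` is the same in
the other variable. -/
theorem map_exact_left {f : A →ₗ[Λᵐᵒᵖ] A'} {g : A' →ₗ[Λᵐᵒᵖ] A''} (hfg : Function.Exact f g)
    (hg : Function.Surjective g) :
    Function.Exact (map f (LinearMap.id : B →ₗ[Λ] B)) (map g LinearMap.id) := by
  intro x
  constructor
  · obtain ⟨t, rfl⟩ := QuotientAddGroup.mk_surjective x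
    intro ht
    obtain ⟨s, hs, hst⟩ := exists_balancedRelations_eq (B := B) (g := LinearMap.id) hg
      Function.surjective_id
      ((QuotientAddGroup.eq_zero_iff _).1 ht)
    obtain ⟨w, hw⟩ := (rTensor_exact B (f := f.toAddMonoidHom.toIntLinearMap)
      (g := g.toAddMonoidHom.toIntLinearMap) hfg hg (t - s)).1
        ((map_sub _ t s).trans (sub_eq_zero.2 hst.symm))
    refine ⟨QuotientAddGroup.mk w, (congrArg QuotientAddGroup.mk hw).trans ?_⟩
    rw [QuotientAddGroup.mk_sub, (QuotientAddGroup.eq_zero_iff s).2 hs, sub_zero]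
  · rintro ⟨y, rfl⟩
    have : (map g LinearMap.id).comp (map f (LinearMap.id : B →ₗ[Λ] B)) = 0 :=
      addHom_ext fun a b => by simp [hfg.apply_apply_eq_zero, zero_tmul]
    exact DFunLike.congr_fun this y

theorem map_exact_right {f : B →ₗ[Λ] B'} {g : B' →ₗ[Λ] B''} (hfg : Function.Exact f g)
    (hg : Function.Surjective g) :
    Function.Exact (map (LinearMap.id : A →ₗ[Λᵐᵒᵖ] A) f) (map LinearMap.id g) := by
  intro x
  constructor
  · obtain ⟨t, rfl⟩ := QuotientAddGroup.mk_surjective x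
    intro ht
    obtain ⟨s, hs, hst⟩ := exists_balancedRelations_eq (A := A) (f := LinearMap.id)
      Function.surjective_id hg
      ((QuotientAddGroup.eq_zero_iff _).1 ht)
    obtain ⟨w, hw⟩ := (lTensor_exact A (f := f.toAddMonoidHom.toIntLinearMap)
      (g := g.toAddMonoidHom.toIntLinearMap) hfg hg (t - s)).1
        ((map_sub _ t s).trans (sub_eq_zero.2 hst.symm))
    refine ⟨QuotientAddGroup.mk w, (congrArg QuotientAddGroup.mk hw).trans ?_⟩
    rw [QuotientAddGroup.mk_sub, (QuotientAddGroup.eq_zero_iff s).2 hs, sub_zero]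
  · rintro ⟨y, rfl⟩
    have : (map LinearMap.id g).comp (map (LinearMap.id : A →ₗ[Λᵐᵒᵖ] A) f) = 0 :=
      addHom_ext fun a b => by simp [hfg.apply_apply_eq_zero, tmul_zero]
    exact DFunLike.congr_fun this y

/-! ### Coordinates, and flatness of projective left modules -/

/-- The homomorphism out of `A ⊗_Λ B` given by a balanced biadditive map. -/
def lift {G : Type*} [AddCommGroup G] (φ : A →+ B →+ G)
    (h : ∀ (a : A) (r : Λ) (b : B), φ (MulOpposite.op r • a) b = φ a (r • b)) :
    BalancedTensor Λ A B →+ G :=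
  QuotientAddGroup.lift _ (TensorProduct.liftAddHom φ fun r a b => by simp) (by
    rw [balancedRelations, AddSubgroup.closure_le]
    rintro _ ⟨a, r, b, rfl⟩
    simp [h])

@[simp]
theorem lift_tmul {G : Type*} [AddCommGroup G] (φ : A →+ B →+ G)
    (h : ∀ (a : A) (r : Λ) (b : B), φ (MulOpposite.op r • a) b = φ a (r • b)) (a : A) (b : B) :
    lift φ h (tmul Λ a b) = φ a b :=
  rfl

theorem smul_tmul (a : A) (r : Λ) (b : B) :
    tmul Λ (MulOpposite.op r • a) b = tmul Λ a (r • b) := by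
  rw [tmul, tmul, QuotientAddGroup.eq, ← neg_mem_iff]
  exact AddSubgroup.subset_closure ⟨a, r, b, by abel⟩

/-- The map `A ⊗_Λ B → A^(I)` with coordinates `a ⊗ b ↦ a s(b)_i`. -/
noncomputable def coords {I : Type*} (s : B →ₗ[Λ] I →₀ Λ) : BalancedTensor Λ A B →+ I →₀ A :=
  lift
    (AddMonoidHom.mk' (fun a => (Finsupp.mapRange.addMonoidHom
      (AddMonoidHom.mk' (fun r : Λ => MulOpposite.op r • a) fun r r' => by
        rw [MulOpposite.op_add, add_smul])).comp s.toAddMonoidHom) fun a a' => by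
      ext b i
      simp)
    fun a r b => by
      ext i
      simp [mul_smul]

@[simp]
theorem coords_tmul {I : Type*} (s : B →ₗ[Λ] I →₀ Λ) (a : A) (b : B) (i : I) :
    coords s (tmul Λ a b) i = MulOpposite.op (s b i) • a :=
  rfl

theorem coords_map {I : Type*} (s : B →ₗ[Λ] I →₀ Λ) (f : A →ₗ[Λᵐᵒᵖ] A')
    (x : BalancedTensor Λ A B) (i : I) :
    coords s (map f LinearMap.id x) i = f (coords s x i) := by
  have : ((Finsupp.applyAddHom i).comp (coords s)).comp (map f LinearMap.id) =
      f.toAddMonoidHom.comp ((Finsupp.applyAddHom i).comp (coords s)) :=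
    addHom_ext fun a b => by simp
  exact DFunLike.congr_fun this x

/-- A section `s` of the canonical surjection `Λ^(B) → B` gives a retraction `ρ` of the coordinate
map, sending `a` placed at `b` to `a ⊗ b`: indeed `∑ a s(b)_i ⊗ i = a ⊗ ∑ s(b)_i i = a ⊗ b`. -/
theorem coords_injective {s : B →ₗ[Λ] B →₀ Λ}
    (hs : Function.LeftInverse (Finsupp.linearCombination Λ id) s) :
    Function.Injective (coords (A := A) s) := by
  let ρ : (B →₀ A) →+ BalancedTensor Λ A B := Finsupp.liftAddHom fun b =>
    AddMonoidHom.mk' (fun a => tmul Λ a b) fun a a' => add_tmul a a' b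
  have : ρ.comp (coords s) = AddMonoidHom.id _ := addHom_ext fun a b => by
    have h1 : coords s (tmul Λ a b) =
        (s b).mapRange (fun r => MulOpposite.op r • a) (by simp) := rfl
    have h2 : tmul Λ a b = AddMonoidHom.mk' (tmul Λ a) (tmul_add a) b := rfl
    simp only [AddMonoidHom.comp_apply, AddMonoidHom.id_apply, h1, ρ, Finsupp.liftAddHom_apply]
    rw [Finsupp.sum_mapRange_index (by simp [zero_tmul])]
    -- Only the `b` on the right is expanded as `∑ s(b)_i i`; `h2` presents `a ⊗ -` as an additive
    -- map so that the sum can be pulled out.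
    conv_rhs => rw [h2, ← hs b, Finsupp.linearCombination_apply, Finsupp.sum, map_sum]
    simp [Finsupp.sum, smul_tmul]
  exact Function.LeftInverse.injective (g := ρ) fun x => DFunLike.congr_fun this x

/-- Projective left modules are flat. -/
theorem map_injective_of_projective [Module.Projective Λ B] {f : A →ₗ[Λᵐᵒᵖ] A'}
    (hf : Function.Injective f) :
    Function.Injective (map f (LinearMap.id : B →ₗ[Λ] B)) := by
  obtain ⟨s, hs⟩ := (Module.projective_def (R := Λ) (P := B)).1 inferInstance
  rw [injective_iff_map_eq_zero]
  intro x hx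
  -- The coordinates of `x` lie in `A`, and `f` sends them to those of the image of `x`, which are
  -- zero; injectivity of `f` concludes.
  refine coords_injective hs ?_
  ext i
  refine hf ?_
  rw [← coords_map, hx]
  simp

end BalancedTensor

end BalancedTensorExactness

/-! ### The homology of a tensor product with a flat complex -/

section TensorHomology

variable {Λ : Type u} [Ring Λ]

instance preservesFiniteColimits_tensorOn (B : ModuleCat.{v} Λ) :
    PreservesFiniteColimits (tensorOn B) := by
  rw [Functor.preservesFiniteColimits_iff_forall_exact_map_and_epi]
  intro S hS
  have hg : Function.Surjective S.g := (ModuleCat.epi_iff_surjective _).1 hS.epi_g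
  have he : Function.Exact S.f S.g :=
    (ShortComplex.ShortExact.moduleCat_exact_iff_function_exact S).1 hS.exact
  exact ⟨(ShortComplex.ab_exact_iff_function_exact _).2 (BalancedTensor.map_exact_left he hg),
    (AddCommGrpCat.epi_iff_surjective _).2
      (BalancedTensor.map_surjective hg Function.surjective_id)⟩

instance preservesFiniteColimits_tensorWith (A : ModuleCat.{v} Λᵐᵒᵖ) :
    PreservesFiniteColimits (tensorWith A) := by
  rw [Functor.preservesFiniteColimits_iff_forall_exact_map_and_epi]
  intro S hS
  have hg : Function.Surjective S.g := (ModuleCat.epi_iff_surjective _).1 hS.epi_g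
  have he : Function.Exact S.f S.g :=
    (ShortComplex.ShortExact.moduleCat_exact_iff_function_exact S).1 hS.exact
  exact ⟨(ShortComplex.ab_exact_iff_function_exact _).2 (BalancedTensor.map_exact_right he hg),
    (AddCommGrpCat.epi_iff_surjective _).2
      (BalancedTensor.map_surjective Function.surjective_id hg)⟩

/-- The functor is already right exact, so preserving monomorphisms makes it exact. The same
argument serves flat right modules below. -/
theorem preservesFiniteLimits_tensorOn [Small.{v} Λ] (P : ModuleCat.{v} Λ) [Projective P] :
    PreservesFiniteLimits (tensorOn P) := by
  have : (tensorOn P).PreservesMonomorphisms := ⟨fun f hf => by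
    rw [AddCommGrpCat.mono_iff_injective]
    exact BalancedTensor.map_injective_of_projective ((ModuleCat.mono_iff_injective f).1 hf)⟩
  have := Functor.preservesHomology_of_preservesMonos_and_cokernels (tensorOn P)
  exact Functor.preservesFiniteLimits_of_preservesHomology _

theorem IsFlatRight.preservesFiniteLimits {A : ModuleCat.{v} Λᵐᵒᵖ} (hA : IsFlatRight A) :
    PreservesFiniteLimits (tensorWith A) := by
  have : (tensorWith A).PreservesMonomorphisms := ⟨fun f hf => by
    rw [AddCommGrpCat.mono_iff_injective]
    exact hA f ((ModuleCat.mono_iff_injective f).1 hf)⟩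
  have := Functor.preservesHomology_of_preservesMonos_and_cokernels (tensorWith A)
  exact Functor.preservesFiniteLimits_of_preservesHomology _

/-! ### The four-term sequence of `H_n(C ⊗ -)` -/

variable (C : ChainComplex (ModuleCat.{v} Λᵐᵒᵖ) ℤ) (n : ℤ)

theorem d_tensorOn_map_pOpcycles (B : ModuleCat.{v} Λ) :
    ((tensorComplex C).obj B).d (n + 1) n ≫ (tensorOn B).map (C.pOpcycles n) = 0 := by
  have : (tensorOn B).map (C.d (n + 1) n) ≫ (tensorOn B).map (C.pOpcycles n) = 0 := by
    rw [← Functor.map_comp, HomologicalComplex.d_pOpcycles, Functor.map_zero]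
  exact this

/-- The comparison map `(C ⊗ B)_n / B_n(C ⊗ B) ⟶ (C_n / B_n) ⊗ B`. -/
noncomputable def opcyclesTensor (B : ModuleCat.{v} Λ) :
    ((tensorComplex C).obj B).opcycles n ⟶ (tensorOn B).obj (C.opcycles n) :=
  ((tensorComplex C).obj B).descOpcycles ((tensorOn B).map (C.pOpcycles n)) (n + 1) (by simp)
    (d_tensorOn_map_pOpcycles C n B)

theorem pOpcycles_opcyclesTensor (B : ModuleCat.{v} Λ) :
    ((tensorComplex C).obj B).pOpcycles n ≫ opcyclesTensor C n B =
      (tensorOn B).map (C.pOpcycles n) :=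
  HomologicalComplex.p_descOpcycles _ _ _ _ _

/-- Both sides are cokernels of `C_{n+1} ⊗ B ⟶ C_n ⊗ B`, because `- ⊗ B` is right exact. -/
instance isIso_opcyclesTensor (B : ModuleCat.{v} Λ) : IsIso (opcyclesTensor C n B) := by
  have h1 := ((tensorComplex C).obj B).opcyclesIsCokernel (n + 1) n (by simp)
  have h2 := isColimitCoforkMapOfIsColimit' (tensorOn B) _
    (C.opcyclesIsCokernel (n + 1) n (by simp))
  have : opcyclesTensor C n B = (h1.coconePointUniqueUpToIso h2).hom := by
    rw [← cancel_epi (((tensorComplex C).obj B).pOpcycles n), pOpcycles_opcyclesTensor]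
    exact (h1.comp_coconePointUniqueUpToIso_hom h2 WalkingParallelPair.one).symm
  rw [this]
  infer_instance

theorem opcyclesTensor_naturality {B B' : ModuleCat.{v} Λ} (f : B ⟶ B') :
    HomologicalComplex.opcyclesMap ((tensorComplex C).map f) n ≫ opcyclesTensor C n B' =
      opcyclesTensor C n B ≫ (tensorWith (C.opcycles n)).map f := by
  rw [← cancel_epi (((tensorComplex C).obj B).pOpcycles n), HomologicalComplex.p_opcyclesMap_assoc,
    pOpcycles_opcyclesTensor, ← Category.assoc, pOpcycles_opcyclesTensor]
  exact (((tensorBifunctor Λ).map (C.pOpcycles n)).naturality f)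

/-- The natural monomorphism `H_n(C ⊗ -) ⟶ (C_n / B_n) ⊗ -`. -/
noncomputable def tensorHomologyι : tensorHomology C n ⟶ tensorWith (C.opcycles n) where
  app B := ((tensorComplex C).obj B).homologyι n ≫ opcyclesTensor C n B
  naturality B B' f := by
    have : HomologicalComplex.homologyMap ((tensorComplex C).map f) n ≫
        ((tensorComplex C).obj B').homologyι n ≫ opcyclesTensor C n B' =
        (((tensorComplex C).obj B).homologyι n ≫ opcyclesTensor C n B) ≫
          (tensorWith (C.opcycles n)).map f := by
      rw [HomologicalComplex.homologyι_naturality_assoc, opcyclesTensor_naturality, Category.assoc]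
    exact this

theorem opcyclesTensor_map_fromOpcycles (B : ModuleCat.{v} Λ) :
    opcyclesTensor C n B ≫ (tensorOn B).map (C.fromOpcycles n (n - 1)) =
      ((tensorComplex C).obj B).fromOpcycles n (n - 1) := by
  have h : (tensorOn B).map (C.pOpcycles n) ≫ (tensorOn B).map (C.fromOpcycles n (n - 1)) =
      (tensorOn B).map (C.d n (n - 1)) := by
    rw [← Functor.map_comp, HomologicalComplex.p_fromOpcycles]
  refine (cancel_epi (((tensorComplex C).obj B).pOpcycles n)).1 ?_
  refine Eq.trans ?_ (HomologicalComplex.p_fromOpcycles _ n (n - 1)).symm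
  refine (Category.assoc _ _ _).symm.trans ?_
  exact (congrArg (· ≫ _) (pOpcycles_opcyclesTensor C n B)).trans h

/-- Homology is the kernel of the map from the opcycles to degree `n - 1`; the opcycles of `C ⊗ B`
are replaced by `(C_n/B_n) ⊗ B`. -/
theorem exact_tensorHomologyι (B : ModuleCat.{v} Λ) :
    ∃ w : (tensorHomologyι C n).app B ≫ (tensorOn B).map (C.fromOpcycles n (n - 1)) = 0,
      (ShortComplex.mk _ _ w).Exact := by
  have h : ∃ w : ((tensorComplex C).obj B).homologyι n ≫
      ((tensorComplex C).obj B).fromOpcycles n (n - 1) = 0, (ShortComplex.mk _ _ w).Exact :=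
    ⟨by simp, ShortComplex.exact_of_f_is_kernel _
      (((tensorComplex C).obj B).homologyIsKernel n (n - 1) (by simp))⟩
  exact ShortComplex.exact_mk_of_iso (Iso.refl _) (asIso (opcyclesTensor C n B)) (Iso.refl _)
    (Category.id_comp _).symm
    ((Category.comp_id _).trans (opcyclesTensor_map_fromOpcycles C n B).symm) h

theorem fromOpcycles_pOpcycles : C.fromOpcycles n (n - 1) ≫ C.pOpcycles (n - 1) = 0 := by
  rw [← cancel_epi (C.pOpcycles n)]
  simp

theorem fromOpcycles_pOpcycles_exact :
    (ShortComplex.mk _ _ (fromOpcycles_pOpcycles C n)).Exact := by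
  have hd : (ShortComplex.mk (C.d n (n - 1)) (C.pOpcycles (n - 1)) (by simp)).Exact :=
    ShortComplex.exact_of_g_is_cokernel _ (C.opcyclesIsCokernel n (n - 1) (by simp))
  exact (ShortComplex.exact_iff_of_epi_of_isIso_of_mono
    (S₁ := ShortComplex.mk (C.d n (n - 1)) (C.pOpcycles (n - 1)) (by simp))
    (S₂ := ShortComplex.mk (C.fromOpcycles n (n - 1)) (C.pOpcycles (n - 1))
      (fromOpcycles_pOpcycles C n))
    { τ₁ := C.pOpcycles n, τ₂ := 𝟙 _, τ₃ := 𝟙 _ }).1 hd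

/-- The exact sequence
`0 ⟶ H_n(C ⊗ -) ⟶ (C_n / B_n) ⊗ - ⟶ C_{n-1} ⊗ - ⟶ (C_{n-1} / B_{n-1}) ⊗ - ⟶ 0`. -/
noncomputable def tensorHomologyFourTermExact :
    FourTermExact (tensorHomology C n) (tensorWith (C.opcycles n)) (tensorWith (C.X (n - 1)))
      (tensorWith (C.opcycles (n - 1))) where
  i := tensorHomologyι C n
  p := (tensorBifunctor Λ).map (C.fromOpcycles n (n - 1))
  q := (tensorBifunctor Λ).map (C.pOpcycles (n - 1))
  i_p B := (exact_tensorHomologyι C n B).1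
  p_q B := ((ShortComplex.mk _ _ (fromOpcycles_pOpcycles C n)).map (tensorOn B)).zero
  mono_i B := mono_comp (((tensorComplex C).obj B).homologyι n) (opcyclesTensor C n B)
  exact_i_p B := (exact_tensorHomologyι C n B).2
  exact_p_q B := (fromOpcycles_pOpcycles_exact C n).map_of_epi_of_preservesCokernel (tensorOn B)
    inferInstance inferInstance
  epi_q B := inferInstanceAs (Epi ((tensorOn B).map (C.pOpcycles (n - 1))))

/-! ### The canonical map `κ` -/

theorem tensorOn_map_homologyι_comp (B : ModuleCat.{v} Λ) :
    (tensorOn B).map (C.homologyι n) ≫ (tensorOn B).map (C.fromOpcycles n (n - 1)) = 0 := by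
  rw [← Functor.map_comp, HomologicalComplex.homologyι_comp_fromOpcycles, Functor.map_zero]

/-- The canonical map `H_n(C) ⊗ B ⟶ H_n(C ⊗ B)`. -/
noncomputable def homologyTensorApp (B : ModuleCat.{v} Λ) :
    (tensorOn B).obj (C.homology n) ⟶ (tensorHomology C n).obj B :=
  have := (tensorHomologyFourTermExact C n).mono_i B
  ((tensorHomologyFourTermExact C n).exact_i_p B).lift _ (tensorOn_map_homologyι_comp C n B)

theorem homologyTensorApp_ι (B : ModuleCat.{v} Λ) :
    homologyTensorApp C n B ≫ (tensorHomologyι C n).app B = (tensorOn B).map (C.homologyι n) :=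
  have := (tensorHomologyFourTermExact C n).mono_i B
  ((tensorHomologyFourTermExact C n).exact_i_p B).lift_f _ (tensorOn_map_homologyι_comp C n B)

/-- The canonical natural transformation `H_n(C) ⊗ - ⟶ H_n(C ⊗ -)`. -/
noncomputable def homologyTensor : tensorWith (C.homology n) ⟶ tensorHomology C n where
  app B := homologyTensorApp C n B
  naturality B B' f := by
    have := (tensorHomologyFourTermExact C n).mono_i B'
    -- After embedding in `(C_n/B_n) ⊗ B'`, the square becomes naturality of the transformation
    -- induced by `H_n(C) ⟶ C_n/B_n`.
    refine (cancel_mono ((tensorHomologyFourTermExact C n).i.app B')).1 ?_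
    refine (Category.assoc _ _ _).trans ?_
    refine (congrArg (_ ≫ ·) (homologyTensorApp_ι C n B')).trans ?_
    refine Eq.trans ?_ (Category.assoc _ _ _).symm
    refine Eq.trans ?_ (congrArg (_ ≫ ·) ((tensorHomologyι C n).naturality f).symm)
    refine Eq.trans ?_ (Category.assoc _ _ _)
    refine Eq.trans ?_ (congrArg (· ≫ _) (homologyTensorApp_ι C n B).symm)
    exact ((tensorBifunctor Λ).map (C.homologyι n)).naturality f

/-- The map was built as a lift through a kernel, so its formula on cycles is checked in `(C_n/B_n)
⊗ B`, where both sides send `z ⊗ b` to the class of `z` tensored with `b`. -/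
theorem isHomologyTensorMap_homologyTensor : IsHomologyTensorMap C n (homologyTensor C n) := by
  intro B
  have := (tensorHomologyFourTermExact C n).mono_i B
  have h1 : (tensorOn B).map (C.homologyπ n) ≫ (tensorOn B).map (C.homologyι n) =
      (tensorOn B).map (C.iCycles n) ≫ (tensorOn B).map (C.pOpcycles n) := by
    rw [← Functor.map_comp, ← Functor.map_comp, HomologicalComplex.homology_π_ι]
  have h2 : cyclesTensor C n B ≫ ((tensorComplex C).obj B).iCycles n =
      (tensorOn B).map (C.iCycles n) := HomologicalComplex.liftCycles_i _ _ _ _ _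
  have h3 : cyclesTensor C n B ≫ ((tensorComplex C).obj B).homologyπ n ≫
      ((tensorComplex C).obj B).homologyι n ≫ opcyclesTensor C n B =
      (tensorOn B).map (C.iCycles n) ≫ (tensorOn B).map (C.pOpcycles n) := by
    rw [HomologicalComplex.homology_π_ι_assoc, pOpcycles_opcyclesTensor]
    exact (Category.assoc _ _ _).symm.trans
      (congrArg (· ≫ (tensorOn B).map (C.pOpcycles n)) h2)
  refine (cancel_mono ((tensorHomologyFourTermExact C n).i.app B)).1 ?_
  refine (Category.assoc _ _ _).trans ?_
  refine (congrArg (_ ≫ ·) (homologyTensorApp_ι C n B)).trans ?_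
  exact h1.trans (h3.symm.trans (Category.assoc _ _ _).symm)

/-- As `- ⊗ P` is exact, `H_n(C) ⊗ P` is itself a kernel of `(C_n/B_n) ⊗ P ⟶ C_{n-1} ⊗ P`, and `κ`
is the comparison of the two kernels. -/
theorem isIso_homologyTensor_app [Small.{v} Λ] (P : ModuleCat.{v} Λ) [Projective P] :
    IsIso ((homologyTensor C n).app P) := by
  have := preservesFiniteLimits_tensorOn P
  have := (tensorHomologyFourTermExact C n).mono_i P
  have h1 := isLimitForkMapOfIsLimit' (tensorOn P) _ (C.homologyIsKernel n (n - 1) (by simp))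
  have h2 := ((tensorHomologyFourTermExact C n).exact_i_p P).fIsKernel
  have : homologyTensorApp C n P = (h1.conePointUniqueUpToIso h2).hom := by
    refine (cancel_mono ((tensorHomologyFourTermExact C n).i.app P)).1 ?_
    refine (homologyTensorApp_ι C n P).trans ?_
    exact (h1.conePointUniqueUpToIso_hom_comp h2 WalkingParallelPair.zero).symm
  change IsIso (homologyTensorApp C n P)
  rw [this]
  infer_instance

variable [Small.{v} Λ]

/-- `L_i H_n(C ⊗ -) ≅ Tor_i(H_n(C), -)`. -/
noncomputable def leftDerivedTensorHomologyIso :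
    ∀ i, (tensorHomology C n).leftDerived i ≅ uctHomologyTerm C n i
  -- The degree `0` term is `H_n(C) ⊗ -` itself, so `L₀` of this right exact functor is removed as
  -- well. In every degree the inverse of `L_i κ` is used, since `κ` points towards `F`.
  | 0 =>
    have := NatTrans.isIso_leftDerived (homologyTensor C n) (isIso_homologyTensor_app C n) 0
    (asIso (NatTrans.leftDerived (homologyTensor C n) 0)).symm ≪≫
      (tensorWith (C.homology n)).leftDerivedZeroIsoSelf
  | i + 1 =>
    have := NatTrans.isIso_leftDerived (homologyTensor C n) (isIso_homologyTensor_app C n) (i + 1)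
    (asIso (NatTrans.leftDerived (homologyTensor C n) (i + 1))).symm

end TensorHomology

theorem mainTheorem8 {Λ : Type u} [Ring Λ] [Small.{v} Λ]
    (C : ChainComplex (ModuleCat.{v} Λᵐᵒᵖ) ℤ) (hC : ∀ i, IsFlatRight (C.X i)) (n : ℤ)
    (R : ∀ B : ModuleCat.{v} Λ, ProjectiveResolution B) :
    (leftFundamentalSequence (tensorHomology C n) R).Exact ∧
    ∃ T : LongSequence (uctHomologyTerm C n) (uctSatelliteTerm C n) (uctQuotStabTerm C n),
      T.Exact ∧ IsHomologyTensorMap C n (T.l 0) ∧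
      ∃ e : (leftFundamentalSequence (tensorHomology C n) R).Iso T,
        (e.isoS 0).hom = 𝟙 (tensorHomology C n) ∧
        ∀ i, (e.isoL (i + 1)).inv =
          NatTrans.leftDerived (F := tensorWith (C.homology n)) (G := tensorHomology C n)
            (T.l 0) (i + 1) := by
  -- Flatness of `C_{n-1}` makes the third functor of the four-term sequence exact.
  have := (hC (n - 1)).preservesFiniteLimits
  have hexact := (tensorHomologyFourTermExact C n).isHalfExact.leftFundamentalSequence_exact R
  let eS : ∀ i, (tensorHomology C n).leftSatellite R i ≅ uctSatelliteTerm C n i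
    | 0 => Iso.refl _
    | i + 1 => (tensorHomologyFourTermExact C n).satelliteIso R i
  let e := (leftFundamentalSequence (tensorHomology C n) R).isoOfIso
    (leftDerivedTensorHomologyIso C n) eS ((tensorHomologyFourTermExact C n).quotStabOmegaIso R)
  -- The transported `λ_F` is `κ`: naturality of `λ` moves `κ` past it, leaving `λ` of `H_n(C) ⊗ -`,
  -- which cancels. The final identity comes from the choice of `Iso.refl` on `F`.
  have hκ : ((tensorWith (C.homology n)).leftDerivedZeroIsoSelf.inv ≫
      NatTrans.leftDerived (homologyTensor C n) 0) ≫
        (tensorHomology C n).fromLeftDerivedZero ≫ 𝟙 _ = homologyTensor C n := by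
    rw [Category.comp_id, Category.assoc, NatTrans.leftDerived_zero_comp_fromLeftDerivedZero,
      Functor.leftDerivedZeroIsoSelf_inv_hom_id_assoc]
  have hl : ((leftFundamentalSequence (tensorHomology C n) R).ofIso
      (leftDerivedTensorHomologyIso C n) eS
      ((tensorHomologyFourTermExact C n).quotStabOmegaIso R)).l 0 = homologyTensor C n := hκ
  refine ⟨hexact, _, hexact.of_iso e, ?_, e, rfl, fun i => ?_⟩
  · rw [hl]
    exact isHomologyTensorMap_homologyTensor C n
  · rw [hl]
    rfl
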